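/- Let $\Bbbk$ be a field, $\otimes=\otimes_{\Bbbk}$, and let $(H,m,u,\Delta,\varepsilon,\omega)$ be a dual quasi-bialgebra. That is, $(H,\Delta,\varepsilon)$ is a coassociative counital coalgebra over $\Bbbk$; $m:H\otimes H\to H$ and $u:\Bbbk\to H$ are coalgebra maps (write $hk=m(h\otimes k)$, $1_H=u(1_{\Bbbk})$) with $1_Hh=h=h1_H$ for all $h\in H$; and $\omega:H\otimes H\otimes H\to\Bbbk$ is a linear map, invertible for the convolution product $*$, such that $$\omega(H\otimes H\otimes m)*\omega(m\otimes H\otimes H)=(\varepsilon\otimes\omega)*\omega(H\otimes m\otimes H)*(\omega\otimes\varepsilon),$$ $\omega(h\otimes k\otimes l)=\varepsilon(h)\varepsilon(k)\varepsilon(l)$ whenever $1_H\in\{h,k,l\}$, and $h_1(k_1l_1)\,\omega(h_2\otimes k_2\otimes l_2)=\omega(h_1\otimes k_1\otimes l_1)\,(h_2k_2)l_2$ for all $h,k,l\in H$. Let ${}^H\mathfrak M$ be the category of left $H$-comodules, with coactions written $v\mapsto v_{-1}\otimes v_0$. Let ${}^H\mathfrak M^H$ be the monoidal category of $H$-bicomodules,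 with codiagonal coactions on $\otimes$, unit object $\Bbbk$ (with the trivial coactions), the usual unit constraints, and associativity constraint $$(x\otimes y)\otimes z\mapsto\omega^{-1}(x_{-1}\otimes y_{-1}\otimes z_{-1})\,x_0\otimes(y_0\otimes z_0)\,\omega(x_1\otimes y_1\otimes z_1).$$ Then $(H,m,u)$, with both coactions equal to $\Delta$, is an algebra in ${}^H\mathfrak M^H$; let ${}^H\mathfrak M^H_H$ be the category of right $H$-modules in ${}^H\mathfrak M^H$ (right dual quasi-Hopf $H$-bicomodules). For a bicomodule $M$, the tensor product $T(M)=M\otimes H$ in ${}^H\mathfrak M^H$ is an object of ${}^H\mathfrak M^H_H$ with action $$(x\otimes h)l=\omega^{-1}(x_{-1}\otimes h_1\otimes l_1)\,x_0\otimes h_2l_2\,\omega(x_1\otimes h_3\otimes l_3).$$ Let $F:{}^H\mathfrak M\to{}^H\mathfrak M^H_H$ be the functor $F(V)=T(V)=V\otimes H$, where $V$ is given the trivial right coaction $v\mapsto v\otimes1_H$. Let $G:{}^H\mathfrak M^H_H\to{}^H\mathfrak M$ be the functor $G(M)=M^{coH}=\{x\in M: x_0\otimes x_1=x\otimes1_H\}$,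 with the restricted left coaction. The functor $F$ is left adjoint to $G$, with unit $\eta_V:V\to(V\otimes H)^{coH}$, $\eta_V(v)=v\otimes1_H$, and counit $\epsilon_M:M^{coH}\otimes H\to M$, $\epsilon_M(x\otimes h)=xh$. Let $H\widehat\otimes H=T({}^{\circ}H^{\bullet})$, where ${}^{\circ}H^{\bullet}$ is $H$ with the trivial left coaction $h\mapsto1_H\otimes h$ and the right coaction $\Delta$. Explicitly, on the vector space $H\otimes H$: $\rho^r(h\otimes k)=(h_1\otimes k_1)\otimes h_2k_2$, $\rho^l(h\otimes k)=k_1\otimes(h\otimes k_2)$ and $(h\otimes k)l=h_1\otimes k_1l_1\,\omega(h_2\otimes k_2\otimes l_2)$. Let $\widehat\epsilon_H=\epsilon_{H\widehat\otimes H}:(H\widehat\otimes H)^{coH}\otimes H\to H\widehat\otimes H$. **Theorem.** The following assertions are equivalent. (i) The adjunction $(F,G)$ is an equivalence of categories, i.e. its unit and its counit are natural isomorphisms. (ii) The map $\widehat\epsilon_H$ is bijective. (iii) There exists a preantipode for $H$, i.e. a $\Bbbk$-linear map $S:H\to H$ such that, for all $h\in H$, $$S(h_1)_1h_2\otimes S(h_1)_2=1_H\otimes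 S(h),\qquad S(h_2)_1\otimes h_1S(h_2)_2=S(h)\otimes1_H,\qquad \omega(h_1\otimes S(h_2)\otimes h_3)=\varepsilon(h).$$ -/

import Mathlib

universe u

namespace DualQuasi

open scoped TensorProduct
open TensorProduct (map assoc lid rid)
open Coalgebra (comul counit)

noncomputable section

set_option linter.unusedSectionVars false

/-- Induction on elements of a tensor product. -/
@[elab_as_elim]
theorem tensor_ind {k A B : Type u} [Field k] [AddCommGroup A] [Module k A] [AddCommGroup B]
    [Module k B] {motive : A ⊗[k] B → Prop} (x : A ⊗[k] B)
    (add : ∀ x y, motive x → motive y → motive (x + y))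
    (tmul : ∀ a b, motive (a ⊗ₜ b)) : motive x :=
  TensorProduct.induction_on x (by simpa using tmul 0 0) tmul add

/-! ### Coactions on vector spaces -/

section Coactions

variable (k : Type u) [Field k] (C D M N : Type u)
  [AddCommGroup C] [Module k C] [Coalgebra k C] [AddCommGroup D] [Module k D] [Coalgebra k D]
  [AddCommGroup M] [Module k M] [AddCommGroup N] [Module k N]

/-- A left `C`-comodule structure on `M`. -/
structure LeftCoaction where
  /-- `m ↦ m₋₁ ⊗ m₀` -/
  toLin : M →ₗ[k] C ⊗[k] M
  coassoc : (assoc k C C M).toLinearMap ∘ₗ map comul LinearMap.id ∘ₗ toLin =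
    map LinearMap.id toLin ∘ₗ toLin
  counit_comp : (lid k M).toLinearMap ∘ₗ map counit LinearMap.id ∘ₗ toLin = LinearMap.id

/-- A right `C`-comodule structure on `M`. -/
structure RightCoaction where
  /-- `m ↦ m₀ ⊗ m₁` -/
  toLin : M →ₗ[k] M ⊗[k] C
  coassoc : (assoc k M C C).toLinearMap ∘ₗ map toLin LinearMap.id ∘ₗ toLin =
    map LinearMap.id comul ∘ₗ toLin
  counit_comp : (rid k M).toLinearMap ∘ₗ map LinearMap.id counit ∘ₗ toLin = LinearMap.id

variable {k C D M N}

/-- The two coactions of a bicomodule commute: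
`m₋₁ ⊗ (m₀₀ ⊗ m₀₁) = m₀₋₁ ⊗ (m₀₀ ⊗ m₁)`. -/
def Commute (l : LeftCoaction k C M) (r : RightCoaction k D M) : Prop :=
  (assoc k C M D).toLinearMap ∘ₗ map l.toLin LinearMap.id ∘ₗ r.toLin =
    map LinearMap.id r.toLin ∘ₗ l.toLin

namespace LeftCoaction

/-- Corestriction of a left coaction along a coalgebra map. -/
def push (f : C →ₗc[k] D) (l : LeftCoaction k C M) : LeftCoaction k D M where
  toLin := map f.toLinearMap LinearMap.id ∘ₗ l.toLin
  coassoc := by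
    ext m
    have h := congr(map f.toLinearMap (map f.toLinearMap LinearMap.id) ($(l.coassoc) m))
    simp only [LinearMap.comp_apply, LinearEquiv.coe_coe] at h ⊢
    convert! h using 1
    · induction l.toLin m using tensor_ind with
      | add x y hx hy => simp only [map_add, hx, hy]
      | tmul c x =>
        simp only [TensorProduct.map_tmul, LinearMap.id_apply]
        have := congr($(f.map_comp_comul) c)
        simp only [LinearMap.comp_apply] at this
        rw [← this]
        induction comul (R := k) c using tensor_ind with
        | add x y hx hy => simp only [map_add, TensorProduct.add_tmul, hx, hy]
        | tmul c d => simp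
    · induction l.toLin m using tensor_ind with
      | add x y hx hy => simp only [map_add, hx, hy]
      | tmul c x => simp
  counit_comp := by
    ext m
    have h := congr($(l.counit_comp) m)
    simp only [LinearMap.comp_apply, LinearEquiv.coe_coe] at h ⊢
    convert! h using 2
    rw [← LinearMap.comp_apply, ← TensorProduct.map_comp, f.counit_comp, LinearMap.comp_id]

/-- The regular left coaction. -/
def regular : LeftCoaction k C C where
  toLin := comul
  coassoc := Coalgebra.coassoc
  counit_comp := by
    ext c
    have := Coalgebra.rTensor_counit_comul (R := k) c
    simp [LinearMap.rTensor] at this ⊢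
    simp [this]

/-- Every vector space as a comodule over the base field. -/
def base : LeftCoaction k k M where
  toLin := (lid k M).symm.toLinearMap
  coassoc := by ext m; simp
  counit_comp := by ext m; simp

/-- The external tensor product of two left comodules:
`m ⊗ n ↦ (m₋₁ ⊗ n₋₁) ⊗ (m₀ ⊗ n₀)`. -/
def tensor (l : LeftCoaction k C M) (l' : LeftCoaction k D N) :
    LeftCoaction k (C ⊗[k] D) (M ⊗[k] N) where
  toLin := (TensorProduct.tensorTensorTensorComm k C M D N).toLinearMap ∘ₗ map l.toLin l'.toLin
  coassoc := by
    refine TensorProduct.ext' fun m n => ?_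
    let F : (C ⊗[k] (C ⊗[k] M)) ⊗[k] (D ⊗[k] (D ⊗[k] N)) →ₗ[k]
        (C ⊗[k] D) ⊗[k] ((C ⊗[k] D) ⊗[k] (M ⊗[k] N)) :=
      map LinearMap.id (TensorProduct.tensorTensorTensorComm k C M D N).toLinearMap ∘ₗ
      (TensorProduct.tensorTensorTensorComm k C (C ⊗[k] M) D (D ⊗[k] N)).toLinearMap
    convert! congr(F ($(l.coassoc) m ⊗ₜ[k] $(l'.coassoc) n)) using 1
    · simp only [LinearMap.comp_apply, LinearEquiv.coe_coe, TensorProduct.map_tmul]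
      induction l.toLin m using tensor_ind with
      | add x y hx hy => simp only [map_add, TensorProduct.add_tmul, hx, hy]
      | tmul c x =>
        induction l'.toLin n using tensor_ind with
        | add x y hx hy => simp only [map_add, TensorProduct.tmul_add, hx, hy]
        | tmul d y =>
          simp only [TensorProduct.map_tmul, TensorProduct.tensorTensorTensorComm_tmul,
            TensorProduct.comul_tmul]
          induction comul (R := k) c using tensor_ind with
          | add x y hx hy => simp only [map_add, TensorProduct.add_tmul, hx, hy]
          | tmul c c' =>
            induction comul (R := k) d using tensor_ind with
            | add x y hx hy => simp only [map_add, TensorProduct.tmul_add, TensorProduct.add_tmul, hx, hy]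
            | tmul d d' => simp [F]
    · simp only [LinearMap.comp_apply, LinearEquiv.coe_coe, TensorProduct.map_tmul]
      induction l.toLin m using tensor_ind with
      | add x y hx hy => simp only [map_add, TensorProduct.add_tmul, hx, hy]
      | tmul c x =>
        induction l'.toLin n using tensor_ind with
        | add x y hx hy => simp only [map_add, TensorProduct.tmul_add, hx, hy]
        | tmul d y => simp [F]
  counit_comp := by
    refine TensorProduct.ext' fun m n => ?_
    convert! congr($(l.counit_comp) m ⊗ₜ[k] $(l'.counit_comp) n) using 1
    simp only [LinearMap.comp_apply, LinearEquiv.coe_coe, TensorProduct.map_tmul]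
    induction l.toLin m using tensor_ind with
    | add x y hx hy => simp only [map_add, TensorProduct.add_tmul, hx, hy]
    | tmul c x =>
      induction l'.toLin n using tensor_ind with
      | add x y hx hy => simp only [map_add, TensorProduct.tmul_add, hx, hy]
      | tmul d y => simp [TensorProduct.smul_tmul', TensorProduct.tmul_smul, smul_smul, mul_comm]

end LeftCoaction

namespace RightCoaction

/-- Corestriction of a right coaction along a coalgebra map. -/
def push (f : C →ₗc[k] D) (r : RightCoaction k C M) : RightCoaction k D M where
  toLin := map LinearMap.id f.toLinearMap ∘ₗ r.toLin
  coassoc := by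
    ext m
    have h := congr(map LinearMap.id (map f.toLinearMap f.toLinearMap) ($(r.coassoc) m))
    simp only [LinearMap.comp_apply, LinearEquiv.coe_coe] at h ⊢
    convert! h using 1
    · induction r.toLin m using tensor_ind with
      | add x y hx hy => simp only [map_add, hx, hy]
      | tmul x c =>
        simp only [TensorProduct.map_tmul, LinearMap.comp_apply, LinearMap.id_apply]
        induction r.toLin x using tensor_ind with
        | add x y hx hy => simp only [map_add, TensorProduct.add_tmul, hx, hy]
        | tmul c d => simp
    · induction r.toLin m using tensor_ind with
      | add x y hx hy => simp only [map_add, hx, hy]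
      | tmul x c =>
        simp only [TensorProduct.map_tmul, LinearMap.id_apply]
        have := congr($(f.map_comp_comul) c)
        simp only [LinearMap.comp_apply] at this
        rw [← this]
  counit_comp := by
    ext m
    have h := congr($(r.counit_comp) m)
    simp only [LinearMap.comp_apply, LinearEquiv.coe_coe] at h ⊢
    convert! h using 2
    rw [← LinearMap.comp_apply, ← TensorProduct.map_comp, f.counit_comp, LinearMap.comp_id]

/-- The regular right coaction. -/
def regular : RightCoaction k C C where
  toLin := comul
  coassoc := Coalgebra.coassoc
  counit_comp := by
    ext c
    have := Coalgebra.lTensor_counit_comul (R := k) c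
    simp [LinearMap.lTensor] at this ⊢
    simp [this]

/-- Every vector space as a comodule over the base field. -/
def base : RightCoaction k k M where
  toLin := (rid k M).symm.toLinearMap
  coassoc := by ext m; simp
  counit_comp := by ext m; simp

/-- The external tensor product of two right comodules:
`m ⊗ n ↦ (m₀ ⊗ n₀) ⊗ (m₁ ⊗ n₁)`. -/
def tensor (r : RightCoaction k C M) (r' : RightCoaction k D N) :
    RightCoaction k (C ⊗[k] D) (M ⊗[k] N) where
  toLin := (TensorProduct.tensorTensorTensorComm k M C N D).toLinearMap ∘ₗ map r.toLin r'.toLin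
  coassoc := by
    refine TensorProduct.ext' fun m n => ?_
    let F : (M ⊗[k] (C ⊗[k] C)) ⊗[k] (N ⊗[k] (D ⊗[k] D)) →ₗ[k]
        (M ⊗[k] N) ⊗[k] ((C ⊗[k] D) ⊗[k] (C ⊗[k] D)) :=
      map LinearMap.id (TensorProduct.tensorTensorTensorComm k C C D D).toLinearMap ∘ₗ
      (TensorProduct.tensorTensorTensorComm k M (C ⊗[k] C) N (D ⊗[k] D)).toLinearMap
    convert! congr(F ($(r.coassoc) m ⊗ₜ[k] $(r'.coassoc) n)) using 1
    · simp only [LinearMap.comp_apply, LinearEquiv.coe_coe, TensorProduct.map_tmul]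
      induction r.toLin m using tensor_ind with
      | add x y hx hy => simp only [map_add, TensorProduct.add_tmul, hx, hy]
      | tmul x c =>
        induction r'.toLin n using tensor_ind with
        | add x y hx hy => simp only [map_add, TensorProduct.tmul_add, hx, hy]
        | tmul y d =>
          simp only [TensorProduct.map_tmul, TensorProduct.tensorTensorTensorComm_tmul,
            LinearMap.comp_apply, LinearEquiv.coe_coe]
          induction r.toLin x using tensor_ind with
          | add x y hx hy => simp only [map_add, TensorProduct.add_tmul, hx, hy]
          | tmul c c' =>
            induction r'.toLin y using tensor_ind with
            | add x y hx hy =>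
              simp only [map_add, TensorProduct.tmul_add, TensorProduct.add_tmul, hx, hy]
            | tmul d d' => simp [F]
    · simp only [LinearMap.comp_apply, LinearEquiv.coe_coe, TensorProduct.map_tmul]
      induction r.toLin m using tensor_ind with
      | add x y hx hy => simp only [map_add, TensorProduct.add_tmul, hx, hy]
      | tmul x c =>
        induction r'.toLin n using tensor_ind with
        | add x y hx hy => simp only [map_add, TensorProduct.tmul_add, hx, hy]
        | tmul y d =>
          simp [F, TensorProduct.AlgebraTensorModule.tensorTensorTensorComm_eq]
  counit_comp := by
    refine TensorProduct.ext' fun m n => ?_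
    convert! congr($(r.counit_comp) m ⊗ₜ[k] $(r'.counit_comp) n) using 1
    simp only [LinearMap.comp_apply, LinearEquiv.coe_coe, TensorProduct.map_tmul]
    induction r.toLin m using tensor_ind with
    | add x y hx hy => simp only [map_add, TensorProduct.add_tmul, hx, hy]
    | tmul x c =>
      induction r'.toLin n using tensor_ind with
      | add x y hx hy => simp only [map_add, TensorProduct.tmul_add, hx, hy]
      | tmul y d => simp [TensorProduct.smul_tmul', TensorProduct.tmul_smul, smul_smul, mul_comm]

end RightCoaction

/-! ### Actions of functionals -/

/-- `φ ▷ m = φ(m₋₁) m₀`. -/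
def LeftCoaction.act (l : LeftCoaction k C M) (φ : C →ₗ[k] k) : M →ₗ[k] M :=
  (lid k M).toLinearMap ∘ₗ map φ LinearMap.id ∘ₗ l.toLin

/-- `m ◁ φ = m₀ φ(m₁)`. -/
def RightCoaction.act (r : RightCoaction k C M) (φ : C →ₗ[k] k) : M →ₗ[k] M :=
  (rid k M).toLinearMap ∘ₗ map LinearMap.id φ ∘ₗ r.toLin

open WithConv

namespace LeftCoaction

/-- `α` is colinear over the map `f` of coalgebras. -/
def Over (f : C →ₗ[k] D) (α : M →ₗ[k] N) (l : LeftCoaction k C M)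
    (l' : LeftCoaction k D N) : Prop :=
  l'.toLin ∘ₗ α = map f α ∘ₗ l.toLin

theorem act_counit (l : LeftCoaction k C M) (m : M) : l.act counit m = m :=
  congr($(l.counit_comp) m)

theorem act_one (l : LeftCoaction k C M) (m : M) :
    l.act (1 : WithConv (C →ₗ[k] k)).ofConv m = m :=
  l.act_counit m

theorem act_act (l : LeftCoaction k C M) (φ ψ : C →ₗ[k] k) (m : M) :
    l.act φ (l.act ψ m) = l.act (toConv ψ * toConv φ).ofConv m := by
  let G : C ⊗[k] (C ⊗[k] M) →ₗ[k] M := (lid k M).toLinearMap ∘ₗ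
    map ψ ((lid k M).toLinearMap ∘ₗ map φ LinearMap.id)
  have h := congr(G ($(l.coassoc) m))
  simp only [LinearMap.comp_apply, LinearEquiv.coe_coe, act] at h ⊢
  convert! h.symm using 1
  · induction l.toLin m using tensor_ind with
    | add x y hx hy => simp only [map_add, hx, hy]
    | tmul c x => simp [G]
  · induction l.toLin m using tensor_ind with
    | add x y hx hy => simp only [map_add, hx, hy]
    | tmul c x =>
      simp only [TensorProduct.map_tmul, LinearMap.convMul_def, LinearMap.comp_apply]
      induction comul (R := k) c using tensor_ind with
      | add x y hx hy => simp only [map_add, TensorProduct.add_tmul, hx, hy]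
      | tmul c d => simp [G, smul_smul, mul_comm]

theorem Over.act {f : C →ₗ[k] D} {α : M →ₗ[k] N} {l : LeftCoaction k C M}
    {l' : LeftCoaction k D N} (h : Over f α l l') (φ : D →ₗ[k] k) (m : M) :
    l'.act φ (α m) = α (l.act (φ ∘ₗ f) m) := by
  have h := congr($h m)
  simp only [LinearMap.comp_apply, LeftCoaction.act] at h ⊢
  rw [h]
  induction l.toLin m using tensor_ind with
  | add x y hx hy => simp only [map_add, hx, hy]
  | tmul c x => simp

theorem Over.comp {E P : Type u} [AddCommGroup E] [Module k E] [Coalgebra k E]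
    [AddCommGroup P] [Module k P]
    {f : C →ₗ[k] D} {α : M →ₗ[k] N} {l : LeftCoaction k C M} {l' : LeftCoaction k D N}
    {g : D →ₗ[k] E} {β : N →ₗ[k] P} {l'' : LeftCoaction k E P}
    (h' : Over g β l' l'') (h : Over f α l l') : Over (g ∘ₗ f) (β ∘ₗ α) l l'' := by
  unfold Over at *
  rw [← LinearMap.comp_assoc, h', LinearMap.comp_assoc, h, TensorProduct.map_comp,
    LinearMap.comp_assoc]

theorem Over.tensor {C' D' M' N' : Type u} [AddCommGroup C'] [Module k C'] [Coalgebra k C']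
    [AddCommGroup D'] [Module k D'] [Coalgebra k D'] [AddCommGroup M'] [Module k M']
    [AddCommGroup N'] [Module k N']
    {f : C →ₗ[k] D} {α : M →ₗ[k] N} {l : LeftCoaction k C M} {l' : LeftCoaction k D N}
    {f' : C' →ₗ[k] D'} {α' : M' →ₗ[k] N'} {q : LeftCoaction k C' M'} {q' : LeftCoaction k D' N'}
    (h : Over f α l l') (h' : Over f' α' q q') :
    Over (map f f') (map α α') (l.tensor q) (l'.tensor q') := by
  unfold Over at *
  refine TensorProduct.ext' fun m n => ?_
  have h := congr($h m)
  have h' := congr($h' n)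
  simp only [LinearMap.comp_apply, LeftCoaction.tensor, TensorProduct.map_tmul,
    LinearEquiv.coe_coe] at h h' ⊢
  rw [h, h']
  induction l.toLin m using tensor_ind with
  | add x y hx hy => simp only [map_add, TensorProduct.add_tmul, hx, hy]
  | tmul c x =>
    induction q.toLin n using tensor_ind with
    | add x y hx hy => simp only [map_add, TensorProduct.tmul_add, hx, hy]
    | tmul d y => simp

theorem Over.id (l : LeftCoaction k C M) : Over LinearMap.id LinearMap.id l l := by
  simp [Over]

theorem Over.push (f : C →ₗc[k] D) (l : LeftCoaction k C M) :
    Over f.toLinearMap LinearMap.id l (l.push f) := by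
  simp [Over, LeftCoaction.push]

theorem Over.assoc {E P : Type u} [AddCommGroup E] [Module k E] [Coalgebra k E]
    [AddCommGroup P] [Module k P]
    (l : LeftCoaction k C M) (l' : LeftCoaction k D N) (l'' : LeftCoaction k E P) :
    Over (TensorProduct.assoc k C D E).toLinearMap (TensorProduct.assoc k M N P).toLinearMap
      ((l.tensor l').tensor l'') (l.tensor (l'.tensor l'')) := by
  unfold Over
  refine TensorProduct.ext_threefold fun m n p => ?_
  simp only [LinearMap.comp_apply, LeftCoaction.tensor, TensorProduct.map_tmul,
    LinearEquiv.coe_coe, TensorProduct.assoc_tmul]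
  induction l.toLin m using tensor_ind with
  | add x y hx hy => simp only [map_add, TensorProduct.add_tmul, hx, hy]
  | tmul c x =>
    induction l'.toLin n using tensor_ind with
    | add x y hx hy => simp only [map_add, TensorProduct.tmul_add, TensorProduct.add_tmul, hx, hy]
    | tmul d y =>
      induction l''.toLin p using tensor_ind with
      | add x y hx hy => simp only [map_add, TensorProduct.tmul_add, hx, hy]
      | tmul e z => simp

theorem act_tensor (l : LeftCoaction k C M) (l' : LeftCoaction k D N) (φ : C →ₗ[k] k)
    (ψ : D →ₗ[k] k) :
    map (l.act φ) (l'.act ψ) = (l.tensor l').act (LinearMap.mul' k k ∘ₗ map φ ψ) := by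
  refine TensorProduct.ext' fun m n => ?_
  simp only [LinearMap.comp_apply, LeftCoaction.tensor, TensorProduct.map_tmul, act,
    LinearEquiv.coe_coe]
  induction l.toLin m using tensor_ind with
  | add x y hx hy => simp only [map_add, TensorProduct.add_tmul, hx, hy]
  | tmul c x =>
    induction l'.toLin n using tensor_ind with
    | add x y hx hy => simp only [map_add, TensorProduct.tmul_add, hx, hy]
    | tmul d y => simp [TensorProduct.smul_tmul', TensorProduct.tmul_smul, smul_smul, mul_comm]

/-- If `φ(c₁) f(c₂) = g(c₁) φ(c₂)`, then `φ ▷ -` is colinear from the `g`-corestriction to the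
`f`-corestriction. -/
theorem toLin_act (l : LeftCoaction k C M) (φ : C →ₗ[k] k) (f g : C →ₗ[k] D)
    (h : (lid k D).toLinearMap ∘ₗ map φ f ∘ₗ comul = (rid k D).toLinearMap ∘ₗ map g φ ∘ₗ comul)
    (m : M) :
    map f LinearMap.id (l.toLin (l.act φ m)) = map g (l.act φ) (l.toLin m) := by
  let G : C ⊗[k] (C ⊗[k] M) →ₗ[k] D ⊗[k] M :=
    (lid k _).toLinearMap ∘ₗ map φ (map f LinearMap.id)
  let G' : C ⊗[k] (C ⊗[k] M) →ₗ[k] D ⊗[k] M :=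
    map g ((lid k _).toLinearMap ∘ₗ map φ LinearMap.id)
  have e : ∀ y : C ⊗[k] M, G (TensorProduct.assoc k C C M (map comul LinearMap.id y)) =
      G' (TensorProduct.assoc k C C M (map comul LinearMap.id y)) := by
    intro y
    induction y using tensor_ind with
    | add x y hx hy => simp only [map_add, hx, hy]
    | tmul c x =>
      have h := congr($h c ⊗ₜ[k] x)
      simp only [TensorProduct.map_tmul, LinearMap.comp_apply, LinearEquiv.coe_coe,
        LinearMap.id_apply] at h ⊢
      convert! h using 1
      · induction comul (R := k) c using tensor_ind with
        | add x y hx hy => simp only [map_add, TensorProduct.add_tmul, hx, hy]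
        | tmul c d => simp [G, TensorProduct.smul_tmul']
      · induction comul (R := k) c using tensor_ind with
        | add x y hx hy => simp only [map_add, TensorProduct.add_tmul, hx, hy]
        | tmul c d => simp [G', TensorProduct.smul_tmul']
  have h1 := congr(G ($(l.coassoc) m))
  have h2 := congr(G' ($(l.coassoc) m))
  simp only [LinearMap.comp_apply, LinearEquiv.coe_coe, act] at h1 h2 ⊢
  rw [e, h2] at h1
  convert! h1.symm using 1
  · induction l.toLin m using tensor_ind with
    | add x y hx hy => simp only [map_add, hx, hy]
    | tmul c x => simp [G]
  · induction l.toLin m using tensor_ind with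
    | add x y hx hy => simp only [map_add, hx, hy]
    | tmul c x => simp [G']

end LeftCoaction


namespace RightCoaction

/-- `α` is colinear over the map `f` of coalgebras. -/
def Over (f : C →ₗ[k] D) (α : M →ₗ[k] N) (r : RightCoaction k C M)
    (r' : RightCoaction k D N) : Prop :=
  r'.toLin ∘ₗ α = map α f ∘ₗ r.toLin

theorem act_counit (r : RightCoaction k C M) (m : M) : r.act counit m = m :=
  congr($(r.counit_comp) m)

theorem act_one (r : RightCoaction k C M) (m : M) :
    r.act (1 : WithConv (C →ₗ[k] k)).ofConv m = m :=
  r.act_counit m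

theorem act_act (r : RightCoaction k C M) (φ ψ : C →ₗ[k] k) (m : M) :
    r.act φ (r.act ψ m) = r.act (toConv φ * toConv ψ).ofConv m := by
  let G : M ⊗[k] (C ⊗[k] C) →ₗ[k] M := (rid k M).toLinearMap ∘ₗ
    map ((rid k M).toLinearMap ∘ₗ map LinearMap.id φ) ψ ∘ₗ (assoc k M C C).symm.toLinearMap
  have h := congr(G ($(r.coassoc) m))
  simp only [LinearMap.comp_apply, LinearEquiv.coe_coe, act] at h ⊢
  convert! h using 1
  · induction r.toLin m using tensor_ind with
    | add x y hx hy => simp only [map_add, hx, hy]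
    | tmul x c => simp [G]
  · induction r.toLin m using tensor_ind with
    | add x y hx hy => simp only [map_add, hx, hy]
    | tmul x c =>
      simp only [TensorProduct.map_tmul, LinearMap.convMul_def, LinearMap.comp_apply]
      induction comul (R := k) c using tensor_ind with
      | add x y hx hy => simp only [map_add, TensorProduct.tmul_add, hx, hy]
      | tmul c d => simp [G, smul_smul, mul_comm]

theorem Over.act {f : C →ₗ[k] D} {α : M →ₗ[k] N} {r : RightCoaction k C M}
    {r' : RightCoaction k D N} (h : Over f α r r') (φ : D →ₗ[k] k) (m : M) :
    r'.act φ (α m) = α (r.act (φ ∘ₗ f) m) := by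
  have h := congr($h m)
  simp only [LinearMap.comp_apply, RightCoaction.act] at h ⊢
  rw [h]
  induction r.toLin m using tensor_ind with
  | add x y hx hy => simp only [map_add, hx, hy]
  | tmul x c => simp

theorem Over.comp {E P : Type u} [AddCommGroup E] [Module k E] [Coalgebra k E]
    [AddCommGroup P] [Module k P]
    {f : C →ₗ[k] D} {α : M →ₗ[k] N} {r : RightCoaction k C M} {r' : RightCoaction k D N}
    {g : D →ₗ[k] E} {β : N →ₗ[k] P} {r'' : RightCoaction k E P}
    (h' : Over g β r' r'') (h : Over f α r r') : Over (g ∘ₗ f) (β ∘ₗ α) r r'' := by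
  unfold Over at *
  rw [← LinearMap.comp_assoc, h', LinearMap.comp_assoc, h, TensorProduct.map_comp,
    LinearMap.comp_assoc]

theorem Over.tensor {C' D' M' N' : Type u} [AddCommGroup C'] [Module k C'] [Coalgebra k C']
    [AddCommGroup D'] [Module k D'] [Coalgebra k D'] [AddCommGroup M'] [Module k M']
    [AddCommGroup N'] [Module k N']
    {f : C →ₗ[k] D} {α : M →ₗ[k] N} {r : RightCoaction k C M} {r' : RightCoaction k D N}
    {f' : C' →ₗ[k] D'} {α' : M' →ₗ[k] N'} {q : RightCoaction k C' M'} {q' : RightCoaction k D' N'}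
    (h : Over f α r r') (h' : Over f' α' q q') :
    Over (map f f') (map α α') (r.tensor q) (r'.tensor q') := by
  unfold Over at *
  refine TensorProduct.ext' fun m n => ?_
  have h := congr($h m)
  have h' := congr($h' n)
  simp only [LinearMap.comp_apply, RightCoaction.tensor, TensorProduct.map_tmul,
    LinearEquiv.coe_coe] at h h' ⊢
  rw [h, h']
  induction r.toLin m using tensor_ind with
  | add x y hx hy => simp only [map_add, TensorProduct.add_tmul, hx, hy]
  | tmul x c =>
    induction q.toLin n using tensor_ind with
    | add x y hx hy => simp only [map_add, TensorProduct.tmul_add, hx, hy]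
    | tmul y d => simp

theorem Over.id (r : RightCoaction k C M) : Over LinearMap.id LinearMap.id r r := by
  simp [Over]

theorem Over.push (f : C →ₗc[k] D) (r : RightCoaction k C M) :
    Over f.toLinearMap LinearMap.id r (r.push f) := by
  simp [Over, RightCoaction.push]

theorem Over.assoc {E P : Type u} [AddCommGroup E] [Module k E] [Coalgebra k E]
    [AddCommGroup P] [Module k P]
    (r : RightCoaction k C M) (r' : RightCoaction k D N) (r'' : RightCoaction k E P) :
    Over (TensorProduct.assoc k C D E).toLinearMap (TensorProduct.assoc k M N P).toLinearMap
      ((r.tensor r').tensor r'') (r.tensor (r'.tensor r'')) := by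
  unfold Over
  refine TensorProduct.ext_threefold fun m n p => ?_
  simp only [LinearMap.comp_apply, RightCoaction.tensor, TensorProduct.map_tmul,
    LinearEquiv.coe_coe, TensorProduct.assoc_tmul]
  induction r.toLin m using tensor_ind with
  | add x y hx hy => simp only [map_add, TensorProduct.add_tmul, hx, hy]
  | tmul x c =>
    induction r'.toLin n using tensor_ind with
    | add x y hx hy => simp only [map_add, TensorProduct.tmul_add, TensorProduct.add_tmul, hx, hy]
    | tmul y d =>
      induction r''.toLin p using tensor_ind with
      | add x y hx hy => simp only [map_add, TensorProduct.tmul_add, hx, hy]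
      | tmul z e => simp

theorem act_tensor (r : RightCoaction k C M) (r' : RightCoaction k D N) (φ : C →ₗ[k] k)
    (ψ : D →ₗ[k] k) :
    map (r.act φ) (r'.act ψ) = (r.tensor r').act (LinearMap.mul' k k ∘ₗ map φ ψ) := by
  refine TensorProduct.ext' fun m n => ?_
  simp only [LinearMap.comp_apply, RightCoaction.tensor, TensorProduct.map_tmul, act,
    LinearEquiv.coe_coe]
  induction r.toLin m using tensor_ind with
  | add x y hx hy => simp only [map_add, TensorProduct.add_tmul, hx, hy]
  | tmul x c =>
    induction r'.toLin n using tensor_ind with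
    | add x y hx hy => simp only [map_add, TensorProduct.tmul_add, hx, hy]
    | tmul y d => simp [TensorProduct.smul_tmul', TensorProduct.tmul_smul, smul_smul, mul_comm]

/-- If `f(c₁) φ(c₂) = φ(c₁) g(c₂)`, then `- ◁ φ` is colinear from the `g`-corestriction to the
`f`-corestriction. -/
theorem toLin_act (r : RightCoaction k C M) (φ : C →ₗ[k] k) (f g : C →ₗ[k] D)
    (h : (rid k D).toLinearMap ∘ₗ map f φ ∘ₗ comul = (lid k D).toLinearMap ∘ₗ map φ g ∘ₗ comul)
    (m : M) :
    map LinearMap.id f (r.toLin (r.act φ m)) = map (r.act φ) g (r.toLin m) := by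
  let G : M ⊗[k] (C ⊗[k] C) →ₗ[k] M ⊗[k] D :=
    map LinearMap.id ((rid k _).toLinearMap ∘ₗ map f φ)
  let G' : M ⊗[k] (C ⊗[k] C) →ₗ[k] M ⊗[k] D :=
    map LinearMap.id ((lid k _).toLinearMap ∘ₗ map φ g)
  have e : ∀ y : M ⊗[k] C, G (map LinearMap.id comul y) = G' (map LinearMap.id comul y) := by
    intro y
    induction y using tensor_ind with
    | add x y hx hy => simp only [map_add, hx, hy]
    | tmul x c =>
      have h := congr(x ⊗ₜ[k] $h c)
      simpa [G, G'] using h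
  have h1 := congr(G ($(r.coassoc) m))
  have h2 := congr(G' ($(r.coassoc) m))
  simp only [LinearMap.comp_apply, LinearEquiv.coe_coe, act] at h1 h2 ⊢
  rw [e, ← h2] at h1
  convert! h1 using 1
  · induction r.toLin m using tensor_ind with
    | add x y hx hy => simp only [map_add, hx, hy]
    | tmul x c =>
      simp only [TensorProduct.map_tmul, LinearMap.id_apply,
        TensorProduct.rid_tmul, map_smul]
      induction r.toLin x using tensor_ind with
      | add x y hx hy => simp only [map_add, smul_add, TensorProduct.add_tmul, hx, hy]
      | tmul x d => simp [G]
  · induction r.toLin m using tensor_ind with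
    | add x y hx hy => simp only [map_add, hx, hy]
    | tmul x c =>
      simp only [TensorProduct.map_tmul, LinearEquiv.coe_coe, LinearMap.id_apply,
        LinearMap.comp_apply]
      induction r.toLin x using tensor_ind with
      | add x y hx hy => simp only [map_add, TensorProduct.add_tmul, hx, hy]
      | tmul x d => simp [G', TensorProduct.smul_tmul']

end RightCoaction

namespace Commute

theorem toLin_act_left {l : LeftCoaction k C M} {r : RightCoaction k D M} (h : Commute l r)
    (φ : C →ₗ[k] k) (m : M) : r.toLin (l.act φ m) = map (l.act φ) LinearMap.id (r.toLin m) := by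
  have h := congr((lid k (M ⊗[k] D)) (map φ LinearMap.id ($h m)))
  simp only [LinearMap.comp_apply, LinearEquiv.coe_coe, LeftCoaction.act] at h ⊢
  convert! h.symm using 1
  · induction l.toLin m using tensor_ind with
    | add x y hx hy => simp only [map_add, hx, hy]
    | tmul c x => simp
  · induction r.toLin m using tensor_ind with
    | add x y hx hy => simp only [map_add, hx, hy]
    | tmul x d =>
      simp only [TensorProduct.map_tmul, LinearEquiv.coe_coe, LinearMap.id_apply,
        LinearMap.comp_apply]
      induction l.toLin x using tensor_ind with
      | add x y hx hy => simp only [map_add, TensorProduct.add_tmul, hx, hy]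
      | tmul c x => simp [TensorProduct.smul_tmul']

theorem toLin_act_right {l : LeftCoaction k C M} {r : RightCoaction k D M} (h : Commute l r)
    (φ : D →ₗ[k] k) (m : M) : l.toLin (r.act φ m) = map LinearMap.id (r.act φ) (l.toLin m) := by
  have h := congr(map LinearMap.id ((rid k M).toLinearMap ∘ₗ map LinearMap.id φ) ($h m))
  simp only [LinearMap.comp_apply, LinearEquiv.coe_coe, RightCoaction.act] at h ⊢
  convert! h using 1
  · induction r.toLin m using tensor_ind with
    | add x y hx hy => simp only [map_add, hx, hy]
    | tmul x d =>
      simp only [TensorProduct.map_tmul, LinearMap.id_apply,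
        TensorProduct.rid_tmul, map_smul]
      induction l.toLin x using tensor_ind with
      | add x y hx hy => simp only [map_add, smul_add, TensorProduct.add_tmul, hx, hy]
      | tmul c x => simp
  · induction l.toLin m using tensor_ind with
    | add x y hx hy => simp only [map_add, hx, hy]
    | tmul c x => simp

theorem act_comm {l : LeftCoaction k C M} {r : RightCoaction k D M} (h : Commute l r)
    (φ : C →ₗ[k] k) (ψ : D →ₗ[k] k) (m : M) : r.act ψ (l.act φ m) = l.act φ (r.act ψ m) := by
  have h := h.toLin_act_left φ m
  simp only [LinearMap.comp_apply, LinearEquiv.coe_coe, RightCoaction.act] at h ⊢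
  rw [h]
  induction r.toLin m using tensor_ind with
  | add x y hx hy => simp only [map_add, hx, hy]
  | tmul x d => simp

theorem push {C' D' : Type u} [AddCommGroup C'] [Module k C'] [Coalgebra k C']
    [AddCommGroup D'] [Module k D'] [Coalgebra k D']
    {l : LeftCoaction k C M} {r : RightCoaction k D M} (h : Commute l r)
    (f : C →ₗc[k] C') (g : D →ₗc[k] D') : Commute (l.push f) (r.push g) := by
  unfold Commute at *
  ext m
  have h := congr(map f.toLinearMap (map LinearMap.id g.toLinearMap) ($h m))
  simp only [LinearMap.comp_apply, LinearEquiv.coe_coe, LeftCoaction.push,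
    RightCoaction.push] at h ⊢
  convert! h using 1
  · induction r.toLin m using tensor_ind with
    | add x y hx hy => simp only [map_add, hx, hy]
    | tmul x d =>
      simp only [TensorProduct.map_tmul, LinearMap.id_apply, LinearMap.comp_apply]
      induction l.toLin x using tensor_ind with
      | add x y hx hy => simp only [map_add, TensorProduct.add_tmul, hx, hy]
      | tmul c x => simp
  · induction l.toLin m using tensor_ind with
    | add x y hx hy => simp only [map_add, hx, hy]
    | tmul c x => simp

theorem tensor {C' D' : Type u} [AddCommGroup C'] [Module k C'] [Coalgebra k C']
    [AddCommGroup D'] [Module k D'] [Coalgebra k D']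
    {l : LeftCoaction k C M} {r : RightCoaction k D M} (h : Commute l r)
    {l' : LeftCoaction k C' N} {r' : RightCoaction k D' N} (h' : Commute l' r') :
    Commute (l.tensor l') (r.tensor r') := by
  unfold Commute at *
  refine TensorProduct.ext' fun m n => ?_
  let F : (C ⊗[k] (M ⊗[k] D)) ⊗[k] (C' ⊗[k] (N ⊗[k] D')) →ₗ[k]
      (C ⊗[k] C') ⊗[k] ((M ⊗[k] N) ⊗[k] (D ⊗[k] D')) :=
    map LinearMap.id (TensorProduct.tensorTensorTensorComm k M D N D').toLinearMap ∘ₗ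
    (TensorProduct.tensorTensorTensorComm k C (M ⊗[k] D) C' (N ⊗[k] D')).toLinearMap
  convert! congr(F ($h m ⊗ₜ[k] $h' n)) using 1
  · simp only [LinearMap.comp_apply, LinearEquiv.coe_coe, TensorProduct.map_tmul,
      LeftCoaction.tensor, RightCoaction.tensor]
    induction r.toLin m using tensor_ind with
    | add x y hx hy => simp only [map_add, TensorProduct.add_tmul, hx, hy]
    | tmul x c =>
      induction r'.toLin n using tensor_ind with
      | add x y hx hy => simp only [map_add, TensorProduct.tmul_add, hx, hy]
      | tmul y d =>
        simp only [TensorProduct.map_tmul, TensorProduct.tensorTensorTensorComm_tmul,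
          LinearMap.comp_apply, LinearEquiv.coe_coe]
        induction l.toLin x using tensor_ind with
        | add x y hx hy => simp only [map_add, TensorProduct.add_tmul, hx, hy]
        | tmul c c' =>
          induction l'.toLin y using tensor_ind with
          | add x y hx hy =>
            simp only [map_add, TensorProduct.tmul_add, TensorProduct.add_tmul, hx, hy]
          | tmul d d' => simp [F]
  · simp only [LinearMap.comp_apply, LinearEquiv.coe_coe, TensorProduct.map_tmul,
      LeftCoaction.tensor, RightCoaction.tensor]
    induction l.toLin m using tensor_ind with
    | add x y hx hy => simp only [map_add, TensorProduct.add_tmul, hx, hy]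
    | tmul c x =>
      induction l'.toLin n using tensor_ind with
      | add x y hx hy => simp only [map_add, TensorProduct.tmul_add, hx, hy]
      | tmul d y => simp [F]

theorem regular : Commute (LeftCoaction.regular : LeftCoaction k C C) RightCoaction.regular :=
  Coalgebra.coassoc

theorem base_left (r : RightCoaction k D M) : Commute LeftCoaction.base r := by
  unfold Commute
  ext m
  have : ∀ y : M ⊗[k] D, assoc k k M D (map (lid k M).symm.toLinearMap LinearMap.id y) =
      1 ⊗ₜ[k] y := by
    intro y
    induction y using tensor_ind with
    | add x y hx hy => simp only [map_add, hx, hy, TensorProduct.tmul_add]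
    | tmul c x => simp
  simp [LeftCoaction.base, this]

theorem base_right (l : LeftCoaction k C M) : Commute l RightCoaction.base := by
  unfold Commute
  ext m
  have : ∀ y : C ⊗[k] M, assoc k C M k (y ⊗ₜ[k] 1) =
      map LinearMap.id (rid k M).symm.toLinearMap y := by
    intro y
    induction y using tensor_ind with
    | add x y hx hy => simp only [map_add, TensorProduct.add_tmul, hx, hy]
    | tmul c x => simp
  simp [RightCoaction.base, this]

end Commute

end Coactions


/-! ### Dual quasi-bialgebras -/

open WithConv in
/-- A dual quasi-bialgebra structure on the coalgebra `H`. The products in `reassoc_mul_inv`,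
`reassoc_inv_mul` and `cocycle` are convolution products of functionals. -/
class DualQuasiBialgebra (k H : Type u) [Field k] [AddCommGroup H] [Module k H]
    [Coalgebra k H] where
  /-- the multiplication `m`, a coalgebra map -/
  mul : H ⊗[k] H →ₗc[k] H
  /-- the unit `u`, a coalgebra map -/
  unit : k →ₗc[k] H
  /-- the reassociator `ω` -/
  reassoc : (H ⊗[k] H) ⊗[k] H →ₗ[k] k
  /-- the convolution inverse `ω⁻¹` of the reassociator -/
  reassocInv : (H ⊗[k] H) ⊗[k] H →ₗ[k] k
  reassoc_mul_inv : toConv reassoc * toConv reassocInv = 1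
  reassoc_inv_mul : toConv reassocInv * toConv reassoc = 1
  /-- `ω(H ⊗ H ⊗ m) * ω(m ⊗ H ⊗ H) = (ε ⊗ ω) * ω(H ⊗ m ⊗ H) * (ω ⊗ ε)` on
  `((H ⊗ H) ⊗ H) ⊗ H` -/
  cocycle :
    toConv (reassoc ∘ₗ map LinearMap.id mul.toLinearMap ∘ₗ
        (assoc k (H ⊗[k] H) H H).toLinearMap) *
      toConv (reassoc ∘ₗ map (map mul.toLinearMap LinearMap.id) LinearMap.id) =
    toConv (LinearMap.mul' k k ∘ₗ map counit reassoc ∘ₗ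
        (assoc k H (H ⊗[k] H) H).toLinearMap ∘ₗ map (assoc k H H H).toLinearMap LinearMap.id) *
      toConv (reassoc ∘ₗ
        map (map LinearMap.id mul.toLinearMap ∘ₗ (assoc k H H H).toLinearMap) LinearMap.id) *
      toConv (LinearMap.mul' k k ∘ₗ map reassoc counit)
  reassoc_unital (g h l : H) : g = unit 1 ∨ h = unit 1 ∨ l = unit 1 →
    reassoc ((g ⊗ₜ h) ⊗ₜ l) = counit g * counit h * counit l
  /-- `m(H ⊗ m) * ω = ω * m(m ⊗ H)`, i.e.
  `g₁(h₁l₁) ω(g₂ ⊗ h₂ ⊗ l₂) = ω(g₁ ⊗ h₁ ⊗ l₁) (g₂h₂)l₂` -/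
  quasi_assoc :
    (rid k H).toLinearMap ∘ₗ
        map (mul.toLinearMap ∘ₗ map LinearMap.id mul.toLinearMap ∘ₗ (assoc k H H H).toLinearMap)
          reassoc ∘ₗ comul =
      (lid k H).toLinearMap ∘ₗ
        map reassoc (mul.toLinearMap ∘ₗ map mul.toLinearMap LinearMap.id) ∘ₗ comul
  unit_mul (h : H) : mul (unit 1 ⊗ₜ h) = h
  mul_unit (h : H) : mul (h ⊗ₜ unit 1) = h

namespace DualQuasiBialgebra

open WithConv

section Convolution

variable {k : Type u} [Field k] {C D : Type u}
  [AddCommGroup C] [Module k C] [Coalgebra k C] [AddCommGroup D] [Module k D] [Coalgebra k D]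

theorem conv_comp_eq_one {φ ψ : D →ₗ[k] k} (h : toConv φ * toConv ψ = 1) (f : C →ₗ[k] D)
    (F : C →ₗc[k] D) (hF : F.toLinearMap = f) : toConv (φ ∘ₗ f) * toConv (ψ ∘ₗ f) = 1 := by
  subst hF
  have h1 := LinearMap.convMul_comp_coalgHom_distrib (toConv φ) (toConv ψ) F
  rw [h] at h1
  apply ofConv_injective
  rw [← h1]
  simp [LinearMap.convOne_def]

theorem conv_map_eq_one {φ ψ : C →ₗ[k] k} {φ' ψ' : D →ₗ[k] k} (h : toConv φ * toConv ψ = 1)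
    (h' : toConv φ' * toConv ψ' = 1) :
    toConv (LinearMap.mul' k k ∘ₗ map φ φ') * toConv (LinearMap.mul' k k ∘ₗ map ψ ψ') = 1 := by
  have h1 := TensorProduct.map_convMul_map (f := toConv φ) (h := toConv ψ) (g := toConv φ')
    (k := toConv ψ')
  rw [h, h'] at h1
  have h2 := LinearMap.algHom_comp_convMul_distrib (R := k) (Algebra.TensorProduct.lmul' k (S := k))
    (toConv (map φ φ')) (toConv (map ψ ψ'))
  apply ofConv_injective
  refine h2.symm.trans ?_
  erw [h1]
  ext c d
  simp [LinearMap.convOne_def, mul_comm]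

end Convolution

variable {k H : Type u} [Field k] [AddCommGroup H] [Module k H] [Coalgebra k H]
  [Q : DualQuasiBialgebra k H]

/-- `m(m ⊗ H)` -/
abbrev mulL : (H ⊗[k] H) ⊗[k] H →ₗ[k] H := Q.mul.toLinearMap ∘ₗ map Q.mul.toLinearMap LinearMap.id

/-- `m(H ⊗ m)` -/
abbrev mulR : (H ⊗[k] H) ⊗[k] H →ₗ[k] H :=
  Q.mul.toLinearMap ∘ₗ map LinearMap.id Q.mul.toLinearMap ∘ₗ (assoc k H H H).toLinearMap

end DualQuasiBialgebra

/-! ### Comodules and bicomodules -/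

open CategoryTheory

section Categories

variable (k H : Type u) [Field k] [AddCommGroup H] [Module k H] [Coalgebra k H]

/-- Left `H`-comodules. -/
structure LeftComod where
  /-- the underlying vector space -/
  carrier : Type u
  [addCommGroup : AddCommGroup carrier]
  [module : Module k carrier]
  /-- the coaction `v ↦ v₋₁ ⊗ v₀` -/
  left : LeftCoaction k H carrier

/-- `H`-bicomodules. -/
structure Bicomod where
  /-- the underlying vector space -/
  carrier : Type u
  [addCommGroup : AddCommGroup carrier]
  [module : Module k carrier]
  /-- the left coaction `v ↦ v₋₁ ⊗ v₀` -/
  left : LeftCoaction k H carrier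
  /-- the right coaction `v ↦ v₀ ⊗ v₁` -/
  right : RightCoaction k H carrier
  commute : Commute left right

attribute [instance] LeftComod.addCommGroup LeftComod.module
attribute [instance] Bicomod.addCommGroup Bicomod.module

variable {k H}

/-- Left colinear maps. -/
@[ext]
structure LeftComod.Hom (V W : LeftComod k H) where
  /-- the underlying linear map -/
  toLin : V.carrier →ₗ[k] W.carrier
  left_colinear : W.left.toLin ∘ₗ toLin = map LinearMap.id toLin ∘ₗ V.left.toLin

/-- Left and right colinear maps. -/
@[ext]
structure Bicomod.Hom (M N : Bicomod k H) where
  /-- the underlying linear map -/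
  toLin : M.carrier →ₗ[k] N.carrier
  left_colinear : N.left.toLin ∘ₗ toLin = map LinearMap.id toLin ∘ₗ M.left.toLin
  right_colinear : N.right.toLin ∘ₗ toLin = map toLin LinearMap.id ∘ₗ M.right.toLin

theorem left_colinear_comp {M N P : Type u} [AddCommGroup M] [Module k M] [AddCommGroup N]
    [Module k N] [AddCommGroup P] [Module k P] {l : M →ₗ[k] H ⊗[k] M} {l' : N →ₗ[k] H ⊗[k] N}
    {l'' : P →ₗ[k] H ⊗[k] P} {f : M →ₗ[k] N} {g : N →ₗ[k] P}
    (hg : l'' ∘ₗ g = map LinearMap.id g ∘ₗ l') (hf : l' ∘ₗ f = map LinearMap.id f ∘ₗ l) :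
    l'' ∘ₗ (g ∘ₗ f) = map LinearMap.id (g ∘ₗ f) ∘ₗ l := by
  rw [← LinearMap.comp_assoc, hg, LinearMap.comp_assoc, hf, ← LinearMap.comp_assoc,
    ← TensorProduct.map_comp, LinearMap.id_comp]

theorem right_colinear_comp {M N P : Type u} [AddCommGroup M] [Module k M] [AddCommGroup N]
    [Module k N] [AddCommGroup P] [Module k P] {r : M →ₗ[k] M ⊗[k] H} {r' : N →ₗ[k] N ⊗[k] H}
    {r'' : P →ₗ[k] P ⊗[k] H} {f : M →ₗ[k] N} {g : N →ₗ[k] P}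
    (hg : r'' ∘ₗ g = map g LinearMap.id ∘ₗ r') (hf : r' ∘ₗ f = map f LinearMap.id ∘ₗ r) :
    r'' ∘ₗ (g ∘ₗ f) = map (g ∘ₗ f) LinearMap.id ∘ₗ r := by
  rw [← LinearMap.comp_assoc, hg, LinearMap.comp_assoc, hf, ← LinearMap.comp_assoc,
    ← TensorProduct.map_comp, LinearMap.id_comp]

instance : Category (LeftComod k H) where
  Hom V W := LeftComod.Hom V W
  id V := ⟨LinearMap.id, LeftCoaction.Over.id V.left⟩
  comp f g := ⟨g.toLin ∘ₗ f.toLin, left_colinear_comp g.left_colinear f.left_colinear⟩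

instance : Category (Bicomod k H) where
  Hom M N := Bicomod.Hom M N
  id M := ⟨LinearMap.id, LeftCoaction.Over.id M.left, RightCoaction.Over.id M.right⟩
  comp f g := ⟨g.toLin ∘ₗ f.toLin, left_colinear_comp g.left_colinear f.left_colinear,
    right_colinear_comp g.right_colinear f.right_colinear⟩

@[simp] theorem LeftComod.id_toLin (V : LeftComod k H) : Hom.toLin (𝟙 V) = LinearMap.id := rfl

@[simp] theorem LeftComod.comp_toLin {U V W : LeftComod k H} (f : U ⟶ V) (g : V ⟶ W) :
    Hom.toLin (f ≫ g) = Hom.toLin g ∘ₗ Hom.toLin f := rfl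

@[simp] theorem Bicomod.id_toLin (V : Bicomod k H) : Hom.toLin (𝟙 V) = LinearMap.id := rfl

@[simp] theorem Bicomod.comp_toLin {U V W : Bicomod k H} (f : U ⟶ V) (g : V ⟶ W) :
    Hom.toLin (f ≫ g) = Hom.toLin g ∘ₗ Hom.toLin f := rfl

theorem LeftComod.hom_ext {V W : LeftComod k H} {f g : V ⟶ W}
    (h : Hom.toLin f = Hom.toLin g) : f = g := LeftComod.Hom.ext h

theorem Bicomod.hom_ext {V W : Bicomod k H} {f g : V ⟶ W}
    (h : Hom.toLin f = Hom.toLin g) : f = g := Bicomod.Hom.ext h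

/-- A bijective bicomodule map is an isomorphism. -/
def Bicomod.isoMk {M N : Bicomod k H} (f : M ⟶ N) (g : N.carrier →ₗ[k] M.carrier)
    (hfg : g ∘ₗ f.toLin = LinearMap.id) (hgf : f.toLin ∘ₗ g = LinearMap.id) : M ≅ N where
  hom := f
  inv := {
    toLin := g
    left_colinear := by
      have h := congr(map LinearMap.id g ∘ₗ $(f.left_colinear) ∘ₗ g)
      rw [LinearMap.comp_assoc, hgf, LinearMap.comp_id, LinearMap.comp_assoc,
        ← LinearMap.comp_assoc _ _ (map _ g), ← TensorProduct.map_comp, hfg, LinearMap.id_comp,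
        TensorProduct.map_id, LinearMap.id_comp] at h
      exact h.symm
    right_colinear := by
      have h := congr(map g LinearMap.id ∘ₗ $(f.right_colinear) ∘ₗ g)
      rw [LinearMap.comp_assoc, hgf, LinearMap.comp_id, LinearMap.comp_assoc,
        ← LinearMap.comp_assoc _ _ (map g _), ← TensorProduct.map_comp, hfg, LinearMap.id_comp,
        TensorProduct.map_id, LinearMap.id_comp] at h
      exact h.symm }
  hom_inv_id := Bicomod.hom_ext hfg
  inv_hom_id := Bicomod.hom_ext hgf

end Categories

/-! ### The monoidal category of bicomodules -/

section Monoidal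

variable {k H : Type u} [Field k] [AddCommGroup H] [Module k H] [Coalgebra k H]
  [Q : DualQuasiBialgebra k H]

open DualQuasiBialgebra WithConv

namespace Bicomod

/-- The tensor product with the codiagonal coactions `ρˡ(v ⊗ w) = v₋₁w₋₁ ⊗ (v₀ ⊗ w₀)` and
`ρʳ(v ⊗ w) = (v₀ ⊗ w₀) ⊗ v₁w₁`. -/
abbrev tensor (V W : Bicomod k H) : Bicomod k H where
  carrier := V.carrier ⊗[k] W.carrier
  left := (V.left.tensor W.left).push Q.mul
  right := (V.right.tensor W.right).push Q.mul
  commute := (V.commute.tensor W.commute).push Q.mul Q.mul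

variable (k H) in
/-- The base field, with the trivial coactions `ρˡ(a) = 1 ⊗ a` and `ρʳ(a) = a ⊗ 1`. -/
abbrev one : Bicomod k H where
  carrier := k
  left := LeftCoaction.base.push Q.unit
  right := RightCoaction.base.push Q.unit
  commute := (Commute.base_left _).push Q.unit Q.unit

/-- The tensor product of two bicomodule maps. -/
def tensorMap {V W V' W' : Bicomod k H} (f : V ⟶ V') (g : W ⟶ W') :
    tensor V W ⟶ tensor V' W' where
  toLin := map f.toLin g.toLin
  left_colinear := by
    have h := congr(map Q.mul.toLinearMap LinearMap.id ∘ₗ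
      $(LeftCoaction.Over.tensor f.left_colinear g.left_colinear))
    rw [← LinearMap.comp_assoc, ← LinearMap.comp_assoc, ← TensorProduct.map_comp] at h
    refine h.trans ?_
    simp only [tensor, LeftCoaction.push]
    rw [← LinearMap.comp_assoc, ← TensorProduct.map_comp, TensorProduct.map_id]
    rfl
  right_colinear := by
    have h := congr(map LinearMap.id Q.mul.toLinearMap ∘ₗ
      $(RightCoaction.Over.tensor f.right_colinear g.right_colinear))
    rw [← LinearMap.comp_assoc, ← LinearMap.comp_assoc, ← TensorProduct.map_comp] at h
    refine h.trans ?_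
    simp only [tensor, RightCoaction.push]
    rw [← LinearMap.comp_assoc, ← TensorProduct.map_comp, TensorProduct.map_id]
    rfl

variable (U V W X : Bicomod k H)

/-- The left coaction of `(H ⊗ H) ⊗ H` on `(U ⊗ V) ⊗ W`. -/
abbrev left3 : LeftCoaction k ((H ⊗[k] H) ⊗[k] H) ((U.carrier ⊗[k] V.carrier) ⊗[k] W.carrier) :=
  (U.left.tensor V.left).tensor W.left

/-- The right coaction of `(H ⊗ H) ⊗ H` on `(U ⊗ V) ⊗ W`. -/
abbrev right3 : RightCoaction k ((H ⊗[k] H) ⊗[k] H) ((U.carrier ⊗[k] V.carrier) ⊗[k] W.carrier) :=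
  (U.right.tensor V.right).tensor W.right

theorem commute3 : Commute (left3 U V W) (right3 U V W) :=
  (U.commute.tensor V.commute).tensor W.commute

/-- `(u ⊗ v) ⊗ w ↦ ω⁻¹(u₋₁ ⊗ v₋₁ ⊗ w₋₁) u₀ ⊗ (v₀ ⊗ w₀) ω(u₁ ⊗ v₁ ⊗ w₁)` -/
def assocLin : (U.carrier ⊗[k] V.carrier) ⊗[k] W.carrier →ₗ[k]
    U.carrier ⊗[k] (V.carrier ⊗[k] W.carrier) :=
  (assoc k U.carrier V.carrier W.carrier).toLinearMap ∘ₗ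
    (right3 U V W).act Q.reassoc ∘ₗ (left3 U V W).act Q.reassocInv

/-- The inverse of `assocLin`. -/
def assocInvLin : U.carrier ⊗[k] (V.carrier ⊗[k] W.carrier) →ₗ[k]
    (U.carrier ⊗[k] V.carrier) ⊗[k] W.carrier :=
  (left3 U V W).act Q.reassoc ∘ₗ (right3 U V W).act Q.reassocInv ∘ₗ
    (assoc k U.carrier V.carrier W.carrier).symm.toLinearMap

theorem assocInvLin_comp : assocInvLin U V W ∘ₗ assocLin U V W = LinearMap.id := by
  apply LinearMap.ext
  intro x
  simp only [assocInvLin, assocLin, LinearMap.comp_apply, LinearEquiv.coe_coe,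
    LinearEquiv.symm_apply_apply, LinearMap.id_apply]
  rw [RightCoaction.act_act, Q.reassoc_inv_mul, RightCoaction.act_one, LeftCoaction.act_act,
    Q.reassoc_inv_mul, LeftCoaction.act_one]

theorem assocLin_comp : assocLin U V W ∘ₗ assocInvLin U V W = LinearMap.id := by
  apply LinearMap.ext
  intro x
  simp only [assocInvLin, assocLin, LinearMap.comp_apply, LinearEquiv.coe_coe,
    LinearMap.id_apply]
  rw [LeftCoaction.act_act, Q.reassoc_mul_inv, LeftCoaction.act_one, RightCoaction.act_act,
    Q.reassoc_mul_inv, RightCoaction.act_one, LinearEquiv.apply_symm_apply]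

theorem left_over_mulR : LeftCoaction.Over mulR
    (assoc k U.carrier V.carrier W.carrier).toLinearMap (left3 U V W)
    (tensor U (tensor V W)).left := by
  have h1 := LeftCoaction.Over.assoc U.left V.left W.left
  have h2 := (LeftCoaction.Over.id U.left).tensor
    (LeftCoaction.Over.push Q.mul (V.left.tensor W.left))
  have h3 := LeftCoaction.Over.push Q.mul
    (U.left.tensor ((V.left.tensor W.left).push Q.mul))
  have := h3.comp (h2.comp h1)
  simp only [TensorProduct.map_id, LinearMap.id_comp] at this
  exact this

theorem left_over_mulL : LeftCoaction.Over mulL LinearMap.id (left3 U V W)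
    (tensor (tensor U V) W).left := by
  have h2 := (LeftCoaction.Over.push Q.mul (U.left.tensor V.left)).tensor
    (LeftCoaction.Over.id W.left)
  have h3 := LeftCoaction.Over.push Q.mul
    (((U.left.tensor V.left).push Q.mul).tensor W.left)
  have := h3.comp h2
  simp only [TensorProduct.map_id, LinearMap.id_comp] at this
  exact this

theorem right_over_mulR : RightCoaction.Over mulR
    (assoc k U.carrier V.carrier W.carrier).toLinearMap (right3 U V W)
    (tensor U (tensor V W)).right := by
  have h1 := RightCoaction.Over.assoc U.right V.right W.right
  have h2 := (RightCoaction.Over.id U.right).tensor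
    (RightCoaction.Over.push Q.mul (V.right.tensor W.right))
  have h3 := RightCoaction.Over.push Q.mul
    (U.right.tensor ((V.right.tensor W.right).push Q.mul))
  have := h3.comp (h2.comp h1)
  simp only [TensorProduct.map_id, LinearMap.id_comp] at this
  exact this

theorem right_over_mulL : RightCoaction.Over mulL LinearMap.id (right3 U V W)
    (tensor (tensor U V) W).right := by
  have h2 := (RightCoaction.Over.push Q.mul (U.right.tensor V.right)).tensor
    (RightCoaction.Over.id W.right)
  have h3 := RightCoaction.Over.push Q.mul
    (((U.right.tensor V.right).push Q.mul).tensor W.right)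
  have := h3.comp h2
  simp only [TensorProduct.map_id, LinearMap.id_comp] at this
  exact this

theorem mulR_act (x : (H ⊗[k] H) ⊗[k] H) :
    mulR (RightCoaction.regular.act Q.reassoc x) =
      mulL (LeftCoaction.regular.act Q.reassoc x) := by
  have h := congr($(Q.quasi_assoc) x)
  simp only [LinearMap.comp_apply, LinearEquiv.coe_coe, LeftCoaction.act, RightCoaction.act,
    LeftCoaction.regular, RightCoaction.regular] at h ⊢
  convert! h using 1
  · induction comul (R := k) x using tensor_ind with
    | add x y hx hy => simp only [map_add, hx, hy]
    | tmul c d => simp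
  · induction comul (R := k) x using tensor_ind with
    | add x y hx hy => simp only [map_add, hx, hy]
    | tmul c d => simp

theorem mulR_act_inv (x : (H ⊗[k] H) ⊗[k] H) :
    mulR (LeftCoaction.regular.act Q.reassocInv x) =
      mulL (RightCoaction.regular.act Q.reassocInv x) := by
  have h := mulR_act
    (RightCoaction.regular.act Q.reassocInv (LeftCoaction.regular.act Q.reassocInv x))
  rw [RightCoaction.act_act, Q.reassoc_mul_inv, RightCoaction.act_one,
    ← Commute.regular.act_comm, LeftCoaction.act_act, Q.reassoc_inv_mul,
    LeftCoaction.act_one] at h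
  exact h

theorem quasi_assoc_inv :
    (lid k H).toLinearMap ∘ₗ map Q.reassocInv mulR ∘ₗ comul =
      (rid k H).toLinearMap ∘ₗ map mulL Q.reassocInv ∘ₗ comul := by
  apply LinearMap.ext
  intro x
  have h := mulR_act_inv x
  simp only [LinearMap.comp_apply, LinearEquiv.coe_coe, LeftCoaction.act, RightCoaction.act,
    LeftCoaction.regular, RightCoaction.regular] at h ⊢
  convert! h using 1
  · induction comul (R := k) x using tensor_ind with
    | add x y hx hy => simp only [map_add, hx, hy]
    | tmul c d => simp
  · induction comul (R := k) x using tensor_ind with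
    | add x y hx hy => simp only [map_add, hx, hy]
    | tmul c d => simp

/-- The associativity constraint. -/
def assocHom : tensor (tensor U V) W ⟶ tensor U (tensor V W) where
  toLin := assocLin U V W
  left_colinear := by
    apply LinearMap.ext
    intro x
    have h1 := congr($(left_over_mulR U V W)
      ((right3 U V W).act Q.reassoc ((left3 U V W).act Q.reassocInv x)))
    have h2 := congr($(left_over_mulL U V W) x)
    have h3 := congr(map LinearMap.id ((assoc k U.carrier V.carrier W.carrier).toLinearMap ∘ₗ
        (right3 U V W).act Q.reassoc)
      $((left3 U V W).toLin_act Q.reassocInv mulR mulL quasi_assoc_inv x))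
    simp only [LinearMap.comp_apply] at h1 h2 ⊢
    refine h1.trans (.trans ?_ congr(map LinearMap.id (assocLin U V W) $h2).symm)
    rw [(commute3 U V W).toLin_act_right]
    simp only [TensorProduct.map_map, LinearMap.comp_id, LinearMap.id_comp] at h3 ⊢
    exact h3
  right_colinear := by
    apply LinearMap.ext
    intro x
    have h1 := congr($(right_over_mulR U V W)
      ((right3 U V W).act Q.reassoc ((left3 U V W).act Q.reassocInv x)))
    have h2 := congr($(right_over_mulL U V W) x)
    have h3 := congr(map (assoc k U.carrier V.carrier W.carrier).toLinearMap LinearMap.id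
      $((right3 U V W).toLin_act Q.reassoc mulR mulL Q.quasi_assoc
        ((left3 U V W).act Q.reassocInv x)))
    simp only [LinearMap.comp_apply] at h1 h2 ⊢
    refine h1.trans (.trans ?_ congr(map (assocLin U V W) LinearMap.id $h2).symm)
    rw [(commute3 U V W).toLin_act_left] at h3
    simp only [TensorProduct.map_map, LinearMap.comp_id, LinearMap.id_comp] at h3 ⊢
    exact h3

/-- The associativity constraint, as an isomorphism. -/
def assocIso : tensor (tensor U V) W ≅ tensor U (tensor V W) :=
  isoMk (assocHom U V W) (assocInvLin U V W) (assocInvLin_comp U V W) (assocLin_comp U V W)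

/-- The left unit constraint `a ⊗ u ↦ a u`. -/
def leftUnitorIso : tensor (one k H) U ≅ U := by
  refine isoMk ⟨(lid k U.carrier).toLinearMap, ?_, ?_⟩ (lid k U.carrier).symm.toLinearMap
    (by ext; simp) (by ext; simp)
  · ext u
    simp only [LinearMap.comp_apply, LeftCoaction.push, LeftCoaction.tensor, LeftCoaction.base,
      TensorProduct.map_tmul, LinearEquiv.coe_coe, TensorProduct.lid_tmul,
      TensorProduct.lid_symm_apply, one_smul, LinearMap.id_apply,
      TensorProduct.AlgebraTensorModule.curry_apply, TensorProduct.curry_apply,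
      LinearMap.restrictScalars_self]
    induction U.left.toLin u using tensor_ind with
    | add x y hx hy =>
      simp only [map_add, TensorProduct.tmul_add]
      exact congr_arg₂ (· + ·) hx hy
    | tmul c x => simp [Q.unit_mul]
  · ext u
    simp only [LinearMap.comp_apply, RightCoaction.push, RightCoaction.tensor, RightCoaction.base,
      TensorProduct.map_tmul, LinearEquiv.coe_coe, TensorProduct.lid_tmul,
      TensorProduct.rid_symm_apply, one_smul, LinearMap.id_apply,
      TensorProduct.AlgebraTensorModule.curry_apply, TensorProduct.curry_apply,
      LinearMap.restrictScalars_self]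
    induction U.right.toLin u using tensor_ind with
    | add x y hx hy =>
      simp only [map_add, TensorProduct.tmul_add]
      exact congr_arg₂ (· + ·) hx hy
    | tmul c x => simp [Q.unit_mul]

/-- The right unit constraint `u ⊗ a ↦ a u`. -/
def rightUnitorIso : tensor U (one k H) ≅ U := by
  refine isoMk ⟨(rid k U.carrier).toLinearMap, ?_, ?_⟩ (rid k U.carrier).symm.toLinearMap
    (by ext; simp) (by ext; simp)
  · ext u
    simp only [LinearMap.comp_apply, LeftCoaction.push, LeftCoaction.tensor, LeftCoaction.base,
      TensorProduct.map_tmul, LinearEquiv.coe_coe, TensorProduct.rid_tmul,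
      TensorProduct.lid_symm_apply, one_smul, LinearMap.id_apply,
      TensorProduct.AlgebraTensorModule.curry_apply, TensorProduct.curry_apply,
      LinearMap.restrictScalars_self]
    induction U.left.toLin u using tensor_ind with
    | add x y hx hy =>
      simp only [map_add, TensorProduct.add_tmul]
      exact congr_arg₂ (· + ·) hx hy
    | tmul c x => simp [Q.mul_unit]
  · ext u
    simp only [LinearMap.comp_apply, RightCoaction.push, RightCoaction.tensor, RightCoaction.base,
      TensorProduct.map_tmul, LinearEquiv.coe_coe, TensorProduct.rid_tmul,
      TensorProduct.rid_symm_apply, one_smul, LinearMap.id_apply,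
      TensorProduct.AlgebraTensorModule.curry_apply, TensorProduct.curry_apply,
      LinearMap.restrictScalars_self]
    induction U.right.toLin u using tensor_ind with
    | add x y hx hy =>
      simp only [map_add, TensorProduct.add_tmul]
      exact congr_arg₂ (· + ·) hx hy
    | tmul c x => simp [Q.mul_unit]

theorem assocLin_naturality {U V W U' V' W' : Bicomod k H} (f : U ⟶ U') (g : V ⟶ V')
    (h : W ⟶ W') :
    assocLin U' V' W' ∘ₗ map (map f.toLin g.toLin) h.toLin =
      map f.toLin (map g.toLin h.toLin) ∘ₗ assocLin U V W := by
  apply LinearMap.ext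
  intro x
  have hl : LeftCoaction.Over (map (map LinearMap.id LinearMap.id) LinearMap.id)
    (map (map f.toLin g.toLin) h.toLin) (left3 U V W) (left3 U' V' W') :=
    (LeftCoaction.Over.tensor f.left_colinear g.left_colinear).tensor h.left_colinear
  have hr : RightCoaction.Over (map (map LinearMap.id LinearMap.id) LinearMap.id)
    (map (map f.toLin g.toLin) h.toLin) (right3 U V W) (right3 U' V' W') :=
    (RightCoaction.Over.tensor f.right_colinear g.right_colinear).tensor h.right_colinear
  simp only [TensorProduct.map_id] at hl hr
  simp only [assocLin, LinearMap.comp_apply]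
  rw [hl.act, hr.act, LinearMap.comp_id, LinearMap.comp_id]
  exact congr($(TensorProduct.map_map_comp_assoc_eq f.toLin g.toLin h.toLin)
    ((right3 U V W).act Q.reassoc ((left3 U V W).act Q.reassocInv x))).symm

/-- The left coaction of `((H ⊗ H) ⊗ H) ⊗ H` on `((U ⊗ V) ⊗ W) ⊗ X`. -/
abbrev left4 : LeftCoaction k (((H ⊗[k] H) ⊗[k] H) ⊗[k] H)
    (((U.carrier ⊗[k] V.carrier) ⊗[k] W.carrier) ⊗[k] X.carrier) :=
  (left3 U V W).tensor X.left

/-- The right coaction of `((H ⊗ H) ⊗ H) ⊗ H` on `((U ⊗ V) ⊗ W) ⊗ X`. -/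
abbrev right4 : RightCoaction k (((H ⊗[k] H) ⊗[k] H) ⊗[k] H)
    (((U.carrier ⊗[k] V.carrier) ⊗[k] W.carrier) ⊗[k] X.carrier) :=
  (right3 U V W).tensor X.right

theorem commute4 : Commute (left4 U V W X) (right4 U V W X) :=
  (commute3 U V W).tensor X.commute

/-- If `α` is colinear over `f` on both sides, the two-sided action is transported by `α`. -/
theorem act_transport {C D M N : Type u} [AddCommGroup C] [Module k C] [Coalgebra k C]
    [AddCommGroup D] [Module k D] [Coalgebra k D] [AddCommGroup M] [Module k M]
    [AddCommGroup N] [Module k N] {l : LeftCoaction k C M} {r : RightCoaction k C M}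
    {l' : LeftCoaction k D N} {r' : RightCoaction k D N} {f : C →ₗ[k] D} {α : M →ₗ[k] N}
    (hl : LeftCoaction.Over f α l l') (hr : RightCoaction.Over f α r r') (φ ψ : D →ₗ[k] k) (m : M) :
    r'.act φ (l'.act ψ (α m)) = α (r.act (φ ∘ₗ f) (l.act (ψ ∘ₗ f) m)) := by
  rw [hl.act, hr.act]

/-- `ω ⊗ ε`, etc. -/
abbrev tensorCounit (φ : (H ⊗[k] H) ⊗[k] H →ₗ[k] k) : ((H ⊗[k] H) ⊗[k] H) ⊗[k] H →ₗ[k] k :=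
  LinearMap.mul' k k ∘ₗ map φ counit

/-- `ε ⊗ ω`, etc. -/
abbrev counitTensor (φ : (H ⊗[k] H) ⊗[k] H →ₗ[k] k) : ((H ⊗[k] H) ⊗[k] H) ⊗[k] H →ₗ[k] k :=
  LinearMap.mul' k k ∘ₗ map counit φ ∘ₗ
        (assoc k H (H ⊗[k] H) H).toLinearMap ∘ₗ map (assoc k H H H).toLinearMap LinearMap.id

theorem act_counit_eq_id {C M : Type u} [AddCommGroup C] [Module k C] [Coalgebra k C]
    [AddCommGroup M] [Module k M] (l : LeftCoaction k C M) : l.act counit = LinearMap.id :=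
  LinearMap.ext l.act_counit

theorem act_counit_eq_id' {C M : Type u} [AddCommGroup C] [Module k C] [Coalgebra k C]
    [AddCommGroup M] [Module k M] (r : RightCoaction k C M) : r.act counit = LinearMap.id :=
  LinearMap.ext r.act_counit

theorem step1 : map (assocLin U V W) (LinearMap.id : X.carrier →ₗ[k] X.carrier) =
    map (assoc k U.carrier V.carrier W.carrier).toLinearMap LinearMap.id ∘ₗ
      (right4 U V W X).act (tensorCounit Q.reassoc) ∘ₗ
      (left4 U V W X).act (tensorCounit Q.reassocInv) := by
  rw [← LeftCoaction.act_tensor, ← RightCoaction.act_tensor, act_counit_eq_id, act_counit_eq_id',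
    ← TensorProduct.map_comp, ← TensorProduct.map_comp]
  rfl

theorem step2 : assocLin U (tensor V W) X ∘ₗ
      map (assoc k U.carrier V.carrier W.carrier).toLinearMap LinearMap.id =
    ((assoc k U.carrier (V.carrier ⊗[k] W.carrier) X.carrier).toLinearMap ∘ₗ
      map (assoc k U.carrier V.carrier W.carrier).toLinearMap LinearMap.id) ∘ₗ
      (right4 U V W X).act (Q.reassoc ∘ₗ
        map (map LinearMap.id Q.mul.toLinearMap ∘ₗ (assoc k H H H).toLinearMap) LinearMap.id) ∘ₗ
      (left4 U V W X).act (Q.reassocInv ∘ₗ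
        map (map LinearMap.id Q.mul.toLinearMap ∘ₗ (assoc k H H H).toLinearMap)
          LinearMap.id) := by
  have hl := (((LeftCoaction.Over.id U.left).tensor
    (LeftCoaction.Over.push Q.mul (V.left.tensor W.left))).comp
    (LeftCoaction.Over.assoc U.left V.left W.left)).tensor (LeftCoaction.Over.id X.left)
  have hr := (((RightCoaction.Over.id U.right).tensor
    (RightCoaction.Over.push Q.mul (V.right.tensor W.right))).comp
    (RightCoaction.Over.assoc U.right V.right W.right)).tensor (RightCoaction.Over.id X.right)
  simp only [TensorProduct.map_id, LinearMap.id_comp] at hl hr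
  apply LinearMap.ext
  intro x
  exact congr((assoc k U.carrier (V.carrier ⊗[k] W.carrier) X.carrier).toLinearMap
    $(act_transport hl hr Q.reassoc Q.reassocInv x))

theorem step3 : map (LinearMap.id : U.carrier →ₗ[k] U.carrier) (assocLin V W X) ∘ₗ
      ((assoc k U.carrier (V.carrier ⊗[k] W.carrier) X.carrier).toLinearMap ∘ₗ
      map (assoc k U.carrier V.carrier W.carrier).toLinearMap LinearMap.id) =
    (map LinearMap.id (assoc k V.carrier W.carrier X.carrier).toLinearMap ∘ₗ
      ((assoc k U.carrier (V.carrier ⊗[k] W.carrier) X.carrier).toLinearMap ∘ₗ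
      map (assoc k U.carrier V.carrier W.carrier).toLinearMap LinearMap.id)) ∘ₗ
      (right4 U V W X).act (counitTensor Q.reassoc) ∘ₗ
      (left4 U V W X).act (counitTensor Q.reassocInv) := by
  have hl := (LeftCoaction.Over.assoc U.left (V.left.tensor W.left) X.left).comp
    ((LeftCoaction.Over.assoc U.left V.left W.left).tensor (LeftCoaction.Over.id X.left))
  have hr := (RightCoaction.Over.assoc U.right (V.right.tensor W.right) X.right).comp
    ((RightCoaction.Over.assoc U.right V.right W.right).tensor (RightCoaction.Over.id X.right))
  have h : map (LinearMap.id : U.carrier →ₗ[k] U.carrier) (assocLin V W X) =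
      map LinearMap.id (assoc k V.carrier W.carrier X.carrier).toLinearMap ∘ₗ
      (U.right.tensor (right3 V W X)).act (LinearMap.mul' k k ∘ₗ map counit Q.reassoc) ∘ₗ
      (U.left.tensor (left3 V W X)).act (LinearMap.mul' k k ∘ₗ map counit Q.reassocInv) := by
    rw [← LeftCoaction.act_tensor, ← RightCoaction.act_tensor, act_counit_eq_id,
      act_counit_eq_id', ← TensorProduct.map_comp, ← TensorProduct.map_comp]
    rfl
  rw [h]
  apply LinearMap.ext
  intro x
  have h1 := act_transport hl hr (LinearMap.mul' k k ∘ₗ map counit Q.reassoc)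
    (LinearMap.mul' k k ∘ₗ map counit Q.reassocInv) x
  simp only [LinearMap.comp_assoc] at h1
  simp only [LinearMap.comp_apply] at h1 ⊢
  rw [h1]

theorem step4 : assocLin (tensor U V) W X =
    (assoc k (U.carrier ⊗[k] V.carrier) W.carrier X.carrier).toLinearMap ∘ₗ
      (right4 U V W X).act (Q.reassoc ∘ₗ
        map (map Q.mul.toLinearMap LinearMap.id) LinearMap.id) ∘ₗ
      (left4 U V W X).act (Q.reassocInv ∘ₗ
        map (map Q.mul.toLinearMap LinearMap.id) LinearMap.id) := by
  have hl := ((LeftCoaction.Over.push Q.mul (U.left.tensor V.left)).tensor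
    (LeftCoaction.Over.id W.left)).tensor (LeftCoaction.Over.id X.left)
  have hr := ((RightCoaction.Over.push Q.mul (U.right.tensor V.right)).tensor
    (RightCoaction.Over.id W.right)).tensor (RightCoaction.Over.id X.right)
  simp only [TensorProduct.map_id] at hl hr
  apply LinearMap.ext
  intro x
  exact congr((assoc k (U.carrier ⊗[k] V.carrier) W.carrier X.carrier).toLinearMap
    $(act_transport hl hr Q.reassoc Q.reassocInv x))

theorem step5 : assocLin U V (tensor W X) ∘ₗ
      (assoc k (U.carrier ⊗[k] V.carrier) W.carrier X.carrier).toLinearMap =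
    ((assoc k U.carrier V.carrier (W.carrier ⊗[k] X.carrier)).toLinearMap ∘ₗ
      (assoc k (U.carrier ⊗[k] V.carrier) W.carrier X.carrier).toLinearMap) ∘ₗ
      (right4 U V W X).act (Q.reassoc ∘ₗ map LinearMap.id Q.mul.toLinearMap ∘ₗ
        (assoc k (H ⊗[k] H) H H).toLinearMap) ∘ₗ
      (left4 U V W X).act (Q.reassocInv ∘ₗ map LinearMap.id Q.mul.toLinearMap ∘ₗ
        (assoc k (H ⊗[k] H) H H).toLinearMap) := by
  have hl := ((LeftCoaction.Over.id (U.left.tensor V.left)).tensor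
    (LeftCoaction.Over.push Q.mul (W.left.tensor X.left))).comp
    (LeftCoaction.Over.assoc (U.left.tensor V.left) W.left X.left)
  have hr := ((RightCoaction.Over.id (U.right.tensor V.right)).tensor
    (RightCoaction.Over.push Q.mul (W.right.tensor X.right))).comp
    (RightCoaction.Over.assoc (U.right.tensor V.right) W.right X.right)
  simp only [TensorProduct.map_id, LinearMap.id_comp] at hl hr
  apply LinearMap.ext
  intro x
  exact congr((assoc k U.carrier V.carrier (W.carrier ⊗[k] X.carrier)).toLinearMap
    $(act_transport hl hr Q.reassoc Q.reassocInv x))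

theorem cocycle_inv :
    toConv (Q.reassocInv ∘ₗ map (map Q.mul.toLinearMap LinearMap.id) LinearMap.id) *
      toConv (Q.reassocInv ∘ₗ map LinearMap.id Q.mul.toLinearMap ∘ₗ
        (assoc k (H ⊗[k] H) H H).toLinearMap) =
    toConv (tensorCounit Q.reassocInv) *
      toConv (Q.reassocInv ∘ₗ
        map (map LinearMap.id Q.mul.toLinearMap ∘ₗ (assoc k H H H).toLinearMap) LinearMap.id) *
      toConv (counitTensor Q.reassocInv) := by
  have e : toConv (counit : H →ₗ[k] k) * toConv counit = 1 := one_mul (M := WithConv (H →ₗ[k] k)) 1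
  let f1 := (Coalgebra.TensorProduct.map (CoalgHom.id k (H ⊗[k] H)) Q.mul).comp
    (Coalgebra.TensorProduct.assoc k k (H ⊗[k] H) H H).toCoalgHom
  let f2 := Coalgebra.TensorProduct.map
    (Coalgebra.TensorProduct.map Q.mul (CoalgHom.id k H)) (CoalgHom.id k H)
  let f3 := Coalgebra.TensorProduct.map
    ((Coalgebra.TensorProduct.map (CoalgHom.id k H) Q.mul).comp
      (Coalgebra.TensorProduct.assoc k k H H H).toCoalgHom) (CoalgHom.id k H)
  let f4 := (Coalgebra.TensorProduct.assoc k k H (H ⊗[k] H) H).toCoalgHom.comp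
    (Coalgebra.TensorProduct.map (Coalgebra.TensorProduct.assoc k k H H H).toCoalgHom
      (CoalgHom.id k H))
  have hA := conv_comp_eq_one (C := ((H ⊗[k] H) ⊗[k] H) ⊗[k] H) Q.reassoc_inv_mul
    (map LinearMap.id Q.mul.toLinearMap ∘ₗ
        (assoc k (H ⊗[k] H) H H).toLinearMap) f1 (by rfl)
  have hB := conv_comp_eq_one (C := ((H ⊗[k] H) ⊗[k] H) ⊗[k] H) Q.reassoc_inv_mul
    (map (map Q.mul.toLinearMap LinearMap.id) LinearMap.id) f2 (by rfl)
  have hR := conv_comp_eq_one (C := ((H ⊗[k] H) ⊗[k] H) ⊗[k] H) Q.reassoc_mul_inv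
    (map (map LinearMap.id Q.mul.toLinearMap ∘ₗ (assoc k H H H).toLinearMap) LinearMap.id) f3 (by rfl)
  have hS := conv_map_eq_one Q.reassoc_mul_inv e
  have e4 : f4.toLinearMap = (assoc k H (H ⊗[k] H) H).toLinearMap ∘ₗ
      map (assoc k H H H).toLinearMap LinearMap.id := rfl
  have hP0 := conv_map_eq_one e Q.reassoc_mul_inv
  have hP := conv_comp_eq_one (C := ((H ⊗[k] H) ⊗[k] H) ⊗[k] H)
    (D := H ⊗[k] ((H ⊗[k] H) ⊗[k] H)) hP0 _ f4 e4
  rw [LinearMap.comp_assoc, LinearMap.comp_assoc] at hP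
  have hc := Q.cocycle
  refine left_inv_eq_right_inv (a := toConv (Q.reassoc ∘ₗ map LinearMap.id Q.mul.toLinearMap ∘ₗ
        (assoc k (H ⊗[k] H) H H).toLinearMap) *
      toConv (Q.reassoc ∘ₗ map (map Q.mul.toLinearMap LinearMap.id) LinearMap.id)) ?_ ?_
  · rw [mul_assoc, ← mul_assoc _ _ (toConv (Q.reassoc ∘ₗ map (map _ _) _)), hA, one_mul, hB]
  · rw [hc]
    simp only [mul_assoc]
    rw [← mul_assoc (toConv (_ ∘ₗ map Q.reassoc _)), hS, one_mul,
      ← mul_assoc (toConv (Q.reassoc ∘ₗ _)), hR, one_mul, hP]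

theorem assocLin_pentagon :
    map LinearMap.id (assocLin V W X) ∘ₗ assocLin U (tensor V W) X ∘ₗ
        map (assocLin U V W) LinearMap.id =
      assocLin U V (tensor W X) ∘ₗ assocLin (tensor U V) W X := by
  apply LinearMap.ext
  intro x
  have s2 := fun y => congr($(step2 U V W X) y)
  have s3 := fun y => congr($(step3 U V W X) y)
  have s5 := fun y => congr($(step5 U V W X) y)
  have hc := congr(map LinearMap.id (assoc k V.carrier W.carrier X.carrier).toLinearMap
    ((assoc k U.carrier (V.carrier ⊗[k] W.carrier) X.carrier).toLinearMap
      (map (assoc k U.carrier V.carrier W.carrier).toLinearMap LinearMap.id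
        ((right4 U V W X).act (ofConv $(Q.cocycle))
          ((left4 U V W X).act (ofConv $(cocycle_inv (k := k) (H := H))) x)))))
  rw [step1, step4]
  simp only [LinearMap.comp_apply] at s2 s3 s5 ⊢
  rw [s2, s3, s5]
  simp only [(commute4 U V W X).act_comm, LeftCoaction.act_act, RightCoaction.act_act] at hc ⊢
  have hp : map LinearMap.id (assoc k V.carrier W.carrier X.carrier).toLinearMap ∘ₗ
      (assoc k U.carrier (V.carrier ⊗[k] W.carrier) X.carrier).toLinearMap ∘ₗ
      map (assoc k U.carrier V.carrier W.carrier).toLinearMap LinearMap.id =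
      (assoc k U.carrier V.carrier (W.carrier ⊗[k] X.carrier)).toLinearMap ∘ₗ
        (assoc k (U.carrier ⊗[k] V.carrier) W.carrier X.carrier).toLinearMap := by
    ext u v w x
    rfl
  refine (Eq.trans ?_ hc.symm).trans congr($hp _)
  simp only [toConv_ofConv, mul_assoc]

theorem reassoc_comp_unit :
    Q.reassoc ∘ₗ map (map LinearMap.id Q.unit.toLinearMap) LinearMap.id =
      (counit : (H ⊗[k] k) ⊗[k] H →ₗ[k] k) := by
  ext g l
  simpa [mul_comm] using Q.reassoc_unital g (Q.unit 1) l (Or.inr (Or.inl rfl))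

theorem reassocInv_comp_unit :
    Q.reassocInv ∘ₗ map (map LinearMap.id Q.unit.toLinearMap) LinearMap.id =
      (counit : (H ⊗[k] k) ⊗[k] H →ₗ[k] k) := by
  have h := conv_comp_eq_one (C := (H ⊗[k] k) ⊗[k] H) Q.reassoc_mul_inv
    (map (map LinearMap.id Q.unit.toLinearMap) LinearMap.id)
    (Coalgebra.TensorProduct.map (Coalgebra.TensorProduct.map (CoalgHom.id k H) Q.unit)
      (CoalgHom.id k H)) (by rfl)
  rw [reassoc_comp_unit] at h
  have h1 : toConv (counit : (H ⊗[k] k) ⊗[k] H →ₗ[k] k) = 1 := rfl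
  rw [h1, _root_.one_mul] at h
  exact congr(ofConv $h)

theorem assocLin_unit : assocLin U (one k H) W =
    (assoc k U.carrier k W.carrier).toLinearMap := by
  have hl := ((LeftCoaction.Over.id U.left).tensor
    (LeftCoaction.Over.push Q.unit (LeftCoaction.base (k := k) (M := k)))).tensor
    (LeftCoaction.Over.id W.left)
  have hr := ((RightCoaction.Over.id U.right).tensor
    (RightCoaction.Over.push Q.unit (RightCoaction.base (k := k) (M := k)))).tensor
    (RightCoaction.Over.id W.right)
  simp only [TensorProduct.map_id] at hl hr
  apply LinearMap.ext
  intro x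
  have := act_transport hl hr Q.reassoc Q.reassocInv x
  rw [reassoc_comp_unit, reassocInv_comp_unit, LeftCoaction.act_counit,
    RightCoaction.act_counit] at this
  exact congr((assoc k U.carrier k W.carrier).toLinearMap $this)

theorem assocLin_triangle : map LinearMap.id (lid k W.carrier).toLinearMap ∘ₗ
    assocLin U (one k H) W = map (rid k U.carrier).toLinearMap LinearMap.id := by
  rw [assocLin_unit]
  ext
  simp

/-- The monoidal category of `H`-bicomodules. -/
instance : MonoidalCategory (Bicomod k H) :=
  letI : MonoidalCategoryStruct (Bicomod k H) := {
    tensorObj := tensor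
    whiskerLeft := fun X _ _ f => tensorMap (𝟙 X) f
    whiskerRight := fun f Y => tensorMap f (𝟙 Y)
    tensorHom := tensorMap
    tensorUnit := one k H
    associator := assocIso
    leftUnitor := leftUnitorIso
    rightUnitor := rightUnitorIso }
  MonoidalCategory.ofTensorHom
    (id_tensorHom_id := fun X Y => hom_ext TensorProduct.map_id)
    (id_tensorHom := fun _ _ _ _ => rfl)
    (tensorHom_id := fun _ _ => rfl)
    (tensorHom_comp_tensorHom := fun f g h i => hom_ext (TensorProduct.map_comp _ _ _ _).symm)
    (associator_naturality := fun f g h => hom_ext (assocLin_naturality f g h))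
    (leftUnitor_naturality := fun {X Y} f => hom_ext (by
      apply TensorProduct.ext'
      intro a x
      exact (map_smul f.toLin a x).symm))
    (rightUnitor_naturality := fun {X Y} f => hom_ext (by
      apply TensorProduct.ext'
      intro x a
      exact (map_smul f.toLin a x).symm))
    (pentagon := fun U V W X => hom_ext (assocLin_pentagon U V W X))
    (triangle := fun U W => hom_ext (assocLin_triangle U W))

end Bicomod
end Monoidal

/-! ### `H` as an algebra in bicomodules, and right dual quasi-Hopf bicomodules -/

section Algebra

variable (k H : Type u) [Field k] [AddCommGroup H] [Module k H] [Coalgebra k H]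
  [Q : DualQuasiBialgebra k H]

open DualQuasiBialgebra WithConv MonoidalCategory

/-- `H` as a bicomodule over itself, both coactions being `Δ`. -/
abbrev Bicomod.regular : Bicomod k H where
  carrier := H
  left := LeftCoaction.regular
  right := RightCoaction.regular
  commute := Commute.regular

/-- `(H, m, u)` is an algebra in the monoidal category of `H`-bicomodules. -/
instance : MonObj (Bicomod.regular k H) where
  one := {
    toLin := Q.unit.toLinearMap
    left_colinear := by
      ext
      have := congr($(Q.unit.map_comp_comul) 1)
      simp only [LinearMap.comp_apply, CommSemiring.comul_apply, TensorProduct.map_tmul] at this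
      exact this.symm
    right_colinear := by
      ext
      have := congr($(Q.unit.map_comp_comul) 1)
      simp only [LinearMap.comp_apply, CommSemiring.comul_apply, TensorProduct.map_tmul] at this
      exact this.symm }
  mul := {
    toLin := Q.mul.toLinearMap
    left_colinear := by
      have h := Q.mul.map_comp_comul
      have e : map Q.mul.toLinearMap Q.mul.toLinearMap =
        map LinearMap.id Q.mul.toLinearMap ∘ₗ map Q.mul.toLinearMap LinearMap.id := by
        rw [← TensorProduct.map_comp, LinearMap.id_comp, LinearMap.comp_id]
      rw [e, LinearMap.comp_assoc] at h
      exact h.symm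
    right_colinear := by
      have h := Q.mul.map_comp_comul
      have e : map Q.mul.toLinearMap Q.mul.toLinearMap =
        map Q.mul.toLinearMap LinearMap.id ∘ₗ map LinearMap.id Q.mul.toLinearMap := by
        rw [← TensorProduct.map_comp, LinearMap.id_comp, LinearMap.comp_id]
      rw [e, LinearMap.comp_assoc] at h
      exact h.symm }
  one_mul := Bicomod.hom_ext (by
    apply TensorProduct.ext'
    intro (a : k) (h : H)
    have e : Q.unit a = a • Q.unit 1 := by rw [← map_smul, smul_eq_mul, _root_.mul_one]
    change Q.mul (Q.unit a ⊗ₜ h) = a • h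
    rw [e, ← TensorProduct.smul_tmul', map_smul, Q.unit_mul])
  mul_one := Bicomod.hom_ext (by
    apply TensorProduct.ext'
    intro (h : H) (a : k)
    have e : Q.unit a = a • Q.unit 1 := by rw [← map_smul, smul_eq_mul, _root_.mul_one]
    change Q.mul (h ⊗ₜ Q.unit a) = a • h
    rw [e, TensorProduct.tmul_smul, map_smul, Q.mul_unit])
  mul_assoc := Bicomod.hom_ext (by
    apply LinearMap.ext
    intro (x : (H ⊗[k] H) ⊗[k] H)
    have h := Bicomod.mulR_act (LeftCoaction.regular.act Q.reassocInv x)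
    rw [LeftCoaction.act_act, Q.reassoc_inv_mul, LeftCoaction.act_one] at h
    exact h.symm)

end Algebra

section RightModules

open MonoidalCategory

universe v₁ u₁

variable {C : Type u₁} [Category.{v₁} C] [MonoidalCategory C] (A : C) [MonObj A]

/-- Right modules over an algebra `A` in a monoidal category. -/
structure RightMod where
  /-- the underlying object -/
  X : C
  /-- the action -/
  act : X ⊗ A ⟶ X
  act_one : X ◁ MonObj.one ≫ act = (ρ_ X).hom
  act_assoc : act ▷ A ≫ act = (α_ X A A).hom ≫ X ◁ MonObj.mul ≫ act

namespace RightMod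

variable {A}

/-- Morphisms of right modules. -/
@[ext]
structure Hom (M N : RightMod A) where
  /-- the underlying morphism -/
  hom : M.X ⟶ N.X
  act_hom : M.act ≫ hom = hom ▷ A ≫ N.act

instance : Category (RightMod A) where
  Hom M N := Hom M N
  id M := ⟨𝟙 M.X, by simp⟩
  comp f g := ⟨f.hom ≫ g.hom, by
    rw [← Category.assoc, f.act_hom, Category.assoc, g.act_hom, comp_whiskerRight,
      Category.assoc]⟩

theorem hom_ext {M N : RightMod A} {f g : M ⟶ N} (h : Hom.hom f = Hom.hom g) : f = g :=
  Hom.ext h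

@[simp] theorem id_hom (M : RightMod A) : Hom.hom (𝟙 M) = 𝟙 M.X := rfl

@[simp] theorem comp_hom {M N P : RightMod A} (f : M ⟶ N) (g : N ⟶ P) :
    Hom.hom (f ≫ g) = Hom.hom f ≫ Hom.hom g := rfl

variable (A)

/-- The forgetful functor `U`. -/
abbrev forget : RightMod A ⥤ C where
  obj M := M.X
  map f := Hom.hom f

/-- The free module functor `T`, `X ↦ (X ⊗ A, (X ⊗ m) ∘ a)`. -/
abbrev free : C ⥤ RightMod A where
  obj X := {
    X := X ⊗ A
    act := (α_ X A A).hom ≫ X ◁ MonObj.mul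
    act_one := by
      rw [associator_naturality_right_assoc, ← MonoidalCategory.whiskerLeft_comp,
        MonObj.mul_one, rightUnitor_tensor_hom]
    act_assoc := by
      rw [comp_whiskerRight, Category.assoc, associator_naturality_middle_assoc,
        ← MonoidalCategory.whiskerLeft_comp, MonObj.mul_assoc,
        associator_naturality_right_assoc, ← MonoidalCategory.whiskerLeft_comp,
        MonoidalCategory.whiskerLeft_comp _ (α_ A A A).hom, pentagon_assoc] }
  map f := ⟨f ▷ A, by simp [whisker_exchange]⟩

/-- The free functor is left adjoint to the forgetful functor; the counit at `M` is the action. -/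
def freeForgetAdj : free A ⊣ forget A := Adjunction.mkOfUnitCounit {
  unit := {
    app := fun X => (ρ_ X).inv ≫ X ◁ MonObj.one
    naturality := fun X Y f => by simp [whisker_exchange] }
  counit := {
    app := fun M => ⟨M.act, by simp [M.act_assoc]⟩
    naturality := fun M N f => hom_ext (Hom.act_hom f).symm }
  left_triangle := by
    ext X
    apply hom_ext
    simp [← MonoidalCategory.whiskerLeft_comp]
  right_triangle := by
    ext M
    simp [M.act_one] }

end RightMod

end RightModules

/-! ### The adjunctions -/

section Adjunctions

variable (k H : Type u) [Field k] [AddCommGroup H] [Module k H] [Coalgebra k H]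
  [Q : DualQuasiBialgebra k H]

open MonoidalCategory

variable {k H}

/-- The trivial right coaction `m ↦ m ⊗ 1`. -/
abbrev trivialRight {M : Type u} [AddCommGroup M] [Module k M] : RightCoaction k H M :=
  RightCoaction.base.push Q.unit

/-- The trivial left coaction `m ↦ 1 ⊗ m`. -/
abbrev trivialLeft {M : Type u} [AddCommGroup M] [Module k M] : LeftCoaction k H M :=
  LeftCoaction.base.push Q.unit

variable (k H) in
/-- The functor `L` that endows a left comodule with the trivial right coaction. -/
abbrev functorL : LeftComod k H ⥤ Bicomod k H where
  obj V := {
    carrier := V.carrier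
    left := V.left
    right := trivialRight
    commute := by
      have h := (Commute.base_right V.left).push (CoalgHom.id k H) Q.unit
      have e : V.left.push (CoalgHom.id k H) = V.left := by
        cases h : V.left
        simp [LeftCoaction.push]
      rwa [e] at h }
  map {V W} f := {
    toLin := f.toLin
    left_colinear := f.left_colinear
    right_colinear := by
      ext v
      simp [RightCoaction.push, RightCoaction.base] }

/-- The space of right coinvariants, `{m | m₀ ⊗ m₁ = m ⊗ 1}`. -/
def coinv (M : Bicomod k H) : Submodule k M.carrier where
  carrier := {m | M.right.toLin m = m ⊗ₜ[k] Q.unit 1}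
  add_mem' {a b} ha hb := by
    change M.right.toLin a = _ at ha
    change M.right.toLin b = _ at hb
    change M.right.toLin (a + b) = _
    rw [map_add, ha, hb, TensorProduct.add_tmul]
  zero_mem' := by simp
  smul_mem' c x hx := by
    change M.right.toLin x = _ at hx
    change M.right.toLin (c • x) = _
    rw [map_smul, hx, TensorProduct.smul_tmul']

theorem mem_coinv {M : Bicomod k H} {m : M.carrier} :
    m ∈ coinv M ↔ M.right.toLin m = m ⊗ₜ[k] Q.unit 1 := Iff.rfl

theorem lTensor_subtype_injective {M : Type u} [AddCommGroup M] [Module k M]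
    (S : Submodule k M) (X : Type u) [AddCommGroup X] [Module k X] :
    Function.Injective (map (LinearMap.id : X →ₗ[k] X) S.subtype) :=
  Module.Flat.lTensor_preserves_injective_linearMap (M := X) S.subtype S.injective_subtype

theorem left_mem_range (M : Bicomod k H) (m : coinv M) :
    M.left.toLin m ∈ LinearMap.range (map (LinearMap.id : H →ₗ[k] H) (coinv M).subtype) := by
  let T : M.carrier →ₗ[k] M.carrier ⊗[k] H := (TensorProduct.mk k M.carrier H).flip (Q.unit 1)
  have e : coinv M = LinearMap.ker (M.right.toLin - T) := by
    ext x
    simp [mem_coinv, T, sub_eq_zero]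
  have h : M.left.toLin m ∈ LinearMap.ker ((M.right.toLin - T).lTensor H) := by
    rw [LinearMap.mem_ker, LinearMap.lTensor_sub, LinearMap.sub_apply, sub_eq_zero]
    have h1 := congr($(M.commute) (m : M.carrier))
    simp only [LinearMap.comp_apply, LinearEquiv.coe_coe] at h1
    refine h1.symm.trans ?_
    rw [mem_coinv.1 m.2]
    simp only [TensorProduct.map_tmul, LinearMap.id_apply]
    induction M.left.toLin m using tensor_ind with
    | add x y hx hy => simp only [map_add, TensorProduct.add_tmul, hx, hy]
    | tmul c x => simp [T]
  rw [LinearMap.exact_iff.1 (Module.Flat.lTensor_exact H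
    (LinearMap.exact_subtype_ker_map (M.right.toLin - T)))] at h
  rw [← e] at h
  exact h

/-- The restriction of the left coaction to the right coinvariants. -/
def coinvLin (M : Bicomod k H) : coinv M →ₗ[k] H ⊗[k] coinv M :=
  (LinearEquiv.ofInjective _ (lTensor_subtype_injective (coinv M) H)).symm.toLinearMap ∘ₗ
    (M.left.toLin ∘ₗ (coinv M).subtype).codRestrict _ (left_mem_range M)

theorem coinvLin_spec (M : Bicomod k H) :
    map LinearMap.id (coinv M).subtype ∘ₗ coinvLin M = M.left.toLin ∘ₗ (coinv M).subtype := by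
  apply LinearMap.ext
  intro m
  have := LinearEquiv.apply_symm_apply
    (LinearEquiv.ofInjective _ (lTensor_subtype_injective (coinv M) H))
    ((M.left.toLin ∘ₗ (coinv M).subtype).codRestrict _ (left_mem_range M) m)
  exact congr(Subtype.val $this)

/-- The left comodule of right coinvariants. -/
abbrev coinvComod (M : Bicomod k H) : LeftComod k H where
  carrier := coinv M
  left := {
    toLin := coinvLin M
    coassoc := by
      have inj : Function.Injective (map (LinearMap.id : H →ₗ[k] H)
          (map (LinearMap.id : H →ₗ[k] H) (coinv M).subtype)) :=
        Module.Flat.lTensor_preserves_injective_linearMap (M := H) _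
          (lTensor_subtype_injective (coinv M) H)
      apply LinearMap.ext
      intro m
      apply inj
      have h := congr($(M.left.coassoc) (m : M.carrier))
      have hm := congr($(coinvLin_spec M) m)
      simp only [LinearMap.comp_apply, LinearEquiv.coe_coe, Submodule.subtype_apply] at h hm ⊢
      rw [← hm] at h
      convert! h using 1
      · induction coinvLin M m using tensor_ind with
        | add x y hx hy => simp only [map_add, hx, hy]
        | tmul c x =>
          simp only [TensorProduct.map_tmul, LinearMap.id_apply]
          induction comul (R := k) c using tensor_ind with
          | add x y hx hy => simp only [map_add, TensorProduct.add_tmul, hx, hy]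
          | tmul c d => simp
      · simp only [TensorProduct.map_map, coinvLin_spec]
    counit_comp := by
      apply LinearMap.ext
      intro m
      apply (coinv M).injective_subtype
      have h := congr($(M.left.counit_comp) (m : M.carrier))
      have hm := congr($(coinvLin_spec M) m)
      simp only [LinearMap.comp_apply, LinearEquiv.coe_coe, Submodule.subtype_apply,
        LinearMap.id_apply] at h hm ⊢
      rw [← hm] at h
      refine .trans ?_ h
      induction coinvLin M m using tensor_ind with
      | add x y hx hy => simp only [map_add, Submodule.coe_add, hx, hy]
      | tmul c x => simp }

theorem coinv_map {M N : Bicomod k H} (f : M ⟶ N) (m : M.carrier) (hm : m ∈ coinv M) :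
    f.toLin m ∈ coinv N := by
  rw [mem_coinv] at hm ⊢
  have := congr($(f.right_colinear) m)
  simp only [LinearMap.comp_apply] at this
  rw [this, hm]
  simp

variable (k H) in
/-- The functor `R` of right coinvariants, `M ↦ M^{co H}`. -/
abbrev functorR : Bicomod k H ⥤ LeftComod k H where
  obj M := coinvComod M
  map {M N} f := {
    toLin := f.toLin.restrict (coinv_map f)
    left_colinear := by
      apply LinearMap.ext
      intro m
      apply lTensor_subtype_injective (coinv N) H
      have h1 := congr($(coinvLin_spec M) m)
      have h2 := congr($(coinvLin_spec N) (f.toLin.restrict (coinv_map f) m))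
      have h := congr($(f.left_colinear) m.1)
      simp only [LinearMap.comp_apply, Submodule.subtype_apply] at h h1 h2 ⊢
      rw [h2, TensorProduct.map_map]
      refine h.trans ?_
      rw [← h1, TensorProduct.map_map]
      rfl }

theorem mem_coinv_functorL (V : LeftComod k H) (v : V.carrier) :
    v ∈ coinv ((functorL k H).obj V) := by
  rw [mem_coinv]
  simp [RightCoaction.push, RightCoaction.base]

variable (k H) in
/-- `L` is left adjoint to `R`; the unit is `v ↦ v` and the counit is the inclusion of the
coinvariants. -/
def adjLR : functorL k H ⊣ functorR k H := Adjunction.mkOfUnitCounit {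
  unit := {
    app := fun V => {
      toLin := LinearMap.codRestrict _ LinearMap.id (mem_coinv_functorL V)
      left_colinear := by
        apply LinearMap.ext
        intro v
        apply lTensor_subtype_injective (coinv ((functorL k H).obj V)) H
        have h1 := congr($(coinvLin_spec ((functorL k H).obj V))
          (LinearMap.codRestrict _ LinearMap.id (mem_coinv_functorL V) v))
        simp only [LinearMap.comp_apply, TensorProduct.map_map] at h1 ⊢
        refine h1.trans ?_
        simp } }
  counit := {
    app := fun M => {
      toLin := (coinv M).subtype
      left_colinear := (coinvLin_spec M).symm
      right_colinear := by
        ext m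
        have := mem_coinv.1 m.2
        simp [RightCoaction.push, RightCoaction.base, this] } } }

variable (k H)

/-- The category of right dual quasi-Hopf `H`-bicomodules: right `H`-modules in the monoidal
category of `H`-bicomodules. -/
abbrev HopfBicomod := RightMod (Bicomod.regular k H)

/-- The functor `F = T L`, `V ↦ V ⊗ H`. -/
abbrev functorF : LeftComod k H ⥤ HopfBicomod k H :=
  functorL k H ⋙ RightMod.free (Bicomod.regular k H)

/-- The functor `G = R U`, `M ↦ M^{co H}`. -/
abbrev functorG : HopfBicomod k H ⥤ LeftComod k H :=
  RightMod.forget (Bicomod.regular k H) ⋙ functorR k H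

/-- The adjunction `(F, G)`. -/
def adjFG : functorF k H ⊣ functorG k H :=
  (adjLR k H).comp (RightMod.freeForgetAdj (Bicomod.regular k H))

/-- `H ⊗̂ H = T(°H•)`: the free right dual quasi-Hopf bicomodule on `H` with the trivial left
coaction and the right coaction `Δ`. -/
abbrev hatTensor : HopfBicomod k H :=
  (RightMod.free (Bicomod.regular k H)).obj {
    carrier := H
    left := trivialLeft
    right := RightCoaction.regular
    commute := by
      have h := (Commute.base_left (k := k) (RightCoaction.regular (k := k) (C := H))).push
        Q.unit (CoalgHom.id k H)
      have e : (RightCoaction.regular (k := k) (C := H)).push (CoalgHom.id k H) =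
          RightCoaction.regular := by
        simp [RightCoaction.push, RightCoaction.regular]
      rwa [e] at h }

/-- The counit `ε̂_H : (H ⊗̂ H)^{co H} ⊗ H → H ⊗̂ H` of the adjunction `(F, G)` at `H ⊗̂ H`. -/
def counitHat : (coinv (hatTensor k H).X) ⊗[k] H →ₗ[k] H ⊗[k] H :=
  Bicomod.Hom.toLin (RightMod.Hom.hom ((adjFG k H).counit.app (hatTensor k H)))

variable {k H}

theorem adjFG_unit (V : LeftComod k H) (v : V.carrier) :
    (((adjFG k H).unit.app V).toLin v).1 = v ⊗ₜ[k] Q.unit 1 := by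
  simp [adjFG, adjLR, RightMod.freeForgetAdj]
  rfl

theorem adjFG_counit (M : HopfBicomod k H) (x : coinv M.X) (h : H) :
    ((adjFG k H).counit.app M).hom.toLin (x ⊗ₜ[k] h) = M.act.toLin (x.1 ⊗ₜ[k] h) := by
  simp [adjFG, adjLR, RightMod.freeForgetAdj]
  rfl

/-- A preantipode for `H`. -/
structure IsPreantipode (S : H →ₗ[k] H) : Prop where
  /-- `S(h₁)₁ h₂ ⊗ S(h₁)₂ = 1 ⊗ S(h)` -/
  left_colinear (h : H) :
    map Q.mul.toLinearMap LinearMap.id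
      (TensorProduct.rightComm k H H H (map (comul ∘ₗ S) LinearMap.id (comul (R := k) h))) =
      Q.unit 1 ⊗ₜ[k] S h
  /-- `S(h₂)₁ ⊗ h₁ S(h₂)₂ = S(h) ⊗ 1` -/
  right_colinear (h : H) :
    map LinearMap.id Q.mul.toLinearMap
      (TensorProduct.leftComm k H H H (map LinearMap.id (comul ∘ₗ S) (comul (R := k) h))) =
      S h ⊗ₜ[k] Q.unit 1
  /-- `ω(h₁ ⊗ S(h₂) ⊗ h₃) = ε(h)` -/
  reassoc_eq (h : H) :
    Q.reassoc (map (map LinearMap.id S ∘ₗ comul) LinearMap.id (comul (R := k) h)) =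
      counit (R := k) h

end Adjunctions

end

end DualQuasi

/-!
The unit of the adjunction is always an isomorphism: `V` carries the trivial right coaction, so the
right coaction of `V ⊗ H` is `V ⊗ Δ`, and applying `ε` to the middle factor shows that the right
coinvariants are the elements `v ⊗ 1` (`isIso_unit`). The theorem is therefore about the counit
`M^{co H} ⊗ H → M`, `x ⊗ h ↦ xh`.

A preantipode `S` is the same as a linear map such that the elements `S(h₁) ⊗ h₂` are coinvariant
for the codiagonal left coaction of `H ⊗ H`, the elements `h₁ ⊗ S(h₂)` are coinvariant for the
codiagonal right coaction, and `ω(h₁ ⊗ S(h₂) ⊗ h₃) = ε(h)` (`IsPreantipode.left_leftTwist`,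
`IsPreantipode.right_rightTwist`, `isPreantipode_of_coinvariant`).

Given a preantipode, let `(H ⊗ H) ⊗ H` act through `ω` on the left of
`twist S m = (m₀ ⊗ S(m₁)) ⊗ m₂` and multiply the first two factors. The resulting map
`counitInv : M → M ⊗ H` takes values in `M^{co H} ⊗ H`, because `m₀ ⊗ S(m₁)` is coinvariant and the
left functionals commute with the right coaction (`counitInv_mem_range`). It is a right inverse of
the action, because the associativity of the action brings in `ω⁻¹` on the left, which cancels `ω`,
and the `ω` remaining on the right is absorbed by the preantipode (`actLin_counitInv`). It sends
`xh` to `x ⊗ h` for coinvariant `x`: the associativity of the action produces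
`ω(m ⊗ H ⊗ H) * (ω⁻¹ ⊗ ε)`, which by the cocycle condition equals
`ω⁻¹(H ⊗ H ⊗ m) * (ε ⊗ ω) * ω(H ⊗ m ⊗ H)`, and the three factors are absorbed one after the other
by the properties of `S` (`counitInv_actLin`). So the counit is bijective.

Conversely, let the counit at `H ⊗̂ H` be bijective, and let `T(h)` be the inverse image of `h ⊗ 1`.
Right colinearity of the inverse gives `T(h) = T'(h₁) ⊗ h₂` with `T'(h) = (id ⊗ ε) T(h)`. Naturality
of the counit with respect to the endomorphisms `h ↦ φ(h₁) h₂`, for all functionals `φ`, gives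
`T'(h) = h₁ ⊗ S(h₂)` with `S = (ε ⊗ H) T'`. Now `T'(h)` is coinvariant by construction, the left
colinearity of the inverse makes `S(h₁) ⊗ h₂` coinvariant, and applying `ε ⊗ ε` to the equation
`(h₁ ⊗ S(h₂)) h₃ = h ⊗ 1` gives the condition on `ω` (`exists_isPreantipode`).
-/

namespace DualQuasi

open scoped TensorProduct
open TensorProduct (map assoc lid rid)
open Coalgebra (comul counit)
open CategoryTheory MonoidalCategory DualQuasiBialgebra WithConv

noncomputable section

set_option linter.unusedSectionVars false

variable {k H : Type u} [Field k] [AddCommGroup H] [Module k H] [Coalgebra k H]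

/-! ### Actions of functionals on tensor products of comodules -/

section Coactions

variable {C D M N : Type u} [AddCommGroup C] [Module k C] [Coalgebra k C]
  [AddCommGroup D] [Module k D] [Coalgebra k D] [AddCommGroup M] [Module k M]
  [AddCommGroup N] [Module k N]

/-- Functionals on the first factor separate the elements of a tensor product. -/
theorem eq_of_forall_functional {x y : M ⊗[k] N}
    (h : ∀ φ : M →ₗ[k] k, lid k N (map φ LinearMap.id x) = lid k N (map φ LinearMap.id y)) :
    x = y := by
  apply (TensorProduct.equivFinsuppOfBasisLeft (N := N) (Module.Free.chooseBasis k M)).injective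
  ext i
  rw [TensorProduct.equivFinsuppOfBasisLeft_apply, TensorProduct.equivFinsuppOfBasisLeft_apply]
  exact h _

/-- If `n ↦ d ⊗ n` under the coaction, a functional `φ` acts on `m ⊗ n` as
`φ(- ⊗ d)` on `m`. -/
theorem LeftCoaction.tensor_act_tmul (l : LeftCoaction k C M) (l' : LeftCoaction k D N)
    (φ : C ⊗[k] D →ₗ[k] k) (m : M) {n : N} {d : D} (hn : l'.toLin n = d ⊗ₜ n) :
    (l.tensor l').act φ (m ⊗ₜ n) = l.act (φ ∘ₗ (TensorProduct.mk k C D).flip d) m ⊗ₜ n := by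
  simp only [act, tensor, LinearMap.comp_apply, TensorProduct.map_tmul, hn, LinearEquiv.coe_coe]
  induction l.toLin m using tensor_ind with
  | add x y hx hy => simp only [map_add, TensorProduct.add_tmul, hx, hy]
  | tmul c x => simp [TensorProduct.smul_tmul']

/-- If `m ↦ m ⊗ c` under the coaction, a functional `φ` acts on `m ⊗ n` as
`φ(c ⊗ -)` on `n`. -/
theorem RightCoaction.tensor_act_tmul (r : RightCoaction k C M) (r' : RightCoaction k D N)
    (φ : C ⊗[k] D →ₗ[k] k) {m : M} (n : N) {c : C} (hm : r.toLin m = m ⊗ₜ c) :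
    (r.tensor r').act φ (m ⊗ₜ n) = m ⊗ₜ r'.act (φ ∘ₗ TensorProduct.mk k C D c) n := by
  simp only [act, tensor, LinearMap.comp_apply, TensorProduct.map_tmul, hm, LinearEquiv.coe_coe]
  induction r'.toLin n using tensor_ind with
  | add x y hx hy => simp only [map_add, TensorProduct.tmul_add, hx, hy]
  | tmul c x => simp [TensorProduct.tmul_smul]

/-- A functional on `C ⊗ D` maps `S ⊗ N` to itself, for each subspace `S` of `M` that is stable
under the functionals on `C`. -/
theorem LeftCoaction.tensor_act_mem_range (l : LeftCoaction k C M) (l' : LeftCoaction k D N)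
    (φ : C ⊗[k] D →ₗ[k] k) (S : Submodule k M) (hS : ∀ (ψ : C →ₗ[k] k), ∀ m ∈ S, l.act ψ m ∈ S)
    {m : M} (hm : m ∈ S) (n : N) :
    (l.tensor l').act φ (m ⊗ₜ n) ∈ LinearMap.range (map S.subtype (LinearMap.id : N →ₗ[k] N)) := by
  simp only [act, tensor, LinearMap.comp_apply, TensorProduct.map_tmul, LinearEquiv.coe_coe]
  induction l'.toLin n using tensor_ind with
  | add x y hx hy =>
    simp only [map_add, TensorProduct.tmul_add]
    exact Submodule.add_mem _ hx hy
  | tmul d y =>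
    refine ⟨⟨l.act (φ ∘ₗ (TensorProduct.mk k C D).flip d) m, hS _ m hm⟩ ⊗ₜ y, ?_⟩
    simp only [TensorProduct.map_tmul, Submodule.subtype_apply, LinearMap.id_apply, act,
      LinearMap.comp_apply, LinearEquiv.coe_coe]
    induction l.toLin m using tensor_ind with
    | add x y hx hy => simp only [map_add, TensorProduct.add_tmul, hx, hy]
    | tmul c x => simp [TensorProduct.smul_tmul']

theorem counit_act_right (φ : C →ₗ[k] k) (c : C) :
    counit (R := k) (RightCoaction.regular.act φ c) = φ c := by
  have h := congr(φ (lid k C $(Coalgebra.rTensor_counit_comul (R := k) c)))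
  rw [TensorProduct.lid_tmul, one_smul] at h
  rw [← h]
  simp only [RightCoaction.act, RightCoaction.regular, LinearMap.comp_apply, LinearEquiv.coe_coe,
    LinearMap.rTensor]
  induction comul (R := k) c using tensor_ind with
  | add x y hx hy => simp only [map_add, hx, hy]
  | tmul c x => simp [mul_comm]

theorem counit_act_left (φ : C →ₗ[k] k) (c : C) :
    counit (R := k) (LeftCoaction.regular.act φ c) = φ c := by
  have h := congr(φ (rid k C $(Coalgebra.lTensor_counit_comul (R := k) c)))
  rw [TensorProduct.rid_tmul, one_smul] at h
  rw [← h]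
  simp only [LeftCoaction.act, LeftCoaction.regular, LinearMap.comp_apply, LinearEquiv.coe_coe,
    LinearMap.lTensor]
  induction comul (R := k) c using tensor_ind with
  | add x y hx hy => simp only [map_add, hx, hy]
  | tmul c x => simp [mul_comm]

end Coactions

variable [Q : DualQuasiBialgebra k H]

theorem comul_unit : comul (R := k) (Q.unit 1) = Q.unit 1 ⊗ₜ[k] Q.unit 1 := by
  have := congr($(Q.unit.map_comp_comul) 1)
  simp only [LinearMap.comp_apply, CommSemiring.comul_apply, TensorProduct.map_tmul] at this
  exact this.symm

theorem reassoc_unit_left :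
    Q.reassoc ∘ₗ map (map Q.unit.toLinearMap LinearMap.id) LinearMap.id =
      (counit : (k ⊗[k] H) ⊗[k] H →ₗ[k] k) := by
  ext g l
  simpa [mul_comm] using Q.reassoc_unital (Q.unit 1) g l (Or.inl rfl)

theorem reassocInv_unit_left :
    Q.reassocInv ∘ₗ map (map Q.unit.toLinearMap LinearMap.id) LinearMap.id =
      (counit : (k ⊗[k] H) ⊗[k] H →ₗ[k] k) := by
  have h := conv_comp_eq_one (C := (k ⊗[k] H) ⊗[k] H) Q.reassoc_mul_inv
    (map (map Q.unit.toLinearMap LinearMap.id) LinearMap.id)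
    (Coalgebra.TensorProduct.map (Coalgebra.TensorProduct.map Q.unit (CoalgHom.id k H))
      (CoalgHom.id k H)) (by rfl)
  rw [reassoc_unit_left] at h
  have h1 : toConv (counit : (k ⊗[k] H) ⊗[k] H →ₗ[k] k) = 1 := rfl
  rw [h1, _root_.one_mul] at h
  exact congr(ofConv $h)

theorem reassoc_unit_right :
    Q.reassoc ∘ₗ map LinearMap.id Q.unit.toLinearMap =
      (counit : (H ⊗[k] H) ⊗[k] k →ₗ[k] k) := by
  ext g l
  simpa [mul_comm] using Q.reassoc_unital g l (Q.unit 1) (Or.inr (Or.inr rfl))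

theorem reassocInv_unit_right :
    Q.reassocInv ∘ₗ map LinearMap.id Q.unit.toLinearMap =
      (counit : (H ⊗[k] H) ⊗[k] k →ₗ[k] k) := by
  have h := conv_comp_eq_one (C := (H ⊗[k] H) ⊗[k] k) Q.reassoc_mul_inv
    (map LinearMap.id Q.unit.toLinearMap)
    (Coalgebra.TensorProduct.map (CoalgHom.id k (H ⊗[k] H)) Q.unit) (by rfl)
  rw [reassoc_unit_right] at h
  have h1 : toConv (counit : (H ⊗[k] H) ⊗[k] k →ₗ[k] k) = 1 := rfl
  rw [h1, _root_.one_mul] at h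
  exact congr(ofConv $h)

/-- A rearrangement of the cocycle condition:
`ω(m ⊗ H ⊗ H) * (ω⁻¹ ⊗ ε) = ω⁻¹(H ⊗ H ⊗ m) * (ε ⊗ ω) * ω(H ⊗ m ⊗ H)`. -/
theorem cocycle_rearranged :
    toConv (Q.reassoc ∘ₗ map (map Q.mul.toLinearMap LinearMap.id) LinearMap.id) *
      toConv (Bicomod.tensorCounit Q.reassocInv) =
    toConv (Q.reassocInv ∘ₗ map LinearMap.id Q.mul.toLinearMap ∘ₗ
        (assoc k (H ⊗[k] H) H H).toLinearMap) *
      (toConv (Bicomod.counitTensor Q.reassoc) *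
      toConv (Q.reassoc ∘ₗ
        map (map LinearMap.id Q.mul.toLinearMap ∘ₗ (assoc k H H H).toLinearMap)
          LinearMap.id)) := by
  have e : toConv (counit : H →ₗ[k] k) * toConv counit = 1 := one_mul (M := WithConv (H →ₗ[k] k)) 1
  let f := (Coalgebra.TensorProduct.map (CoalgHom.id k (H ⊗[k] H)) Q.mul).comp
    (Coalgebra.TensorProduct.assoc k k (H ⊗[k] H) H H).toCoalgHom
  have hA := conv_comp_eq_one (C := ((H ⊗[k] H) ⊗[k] H) ⊗[k] H) Q.reassoc_inv_mul
    (map LinearMap.id Q.mul.toLinearMap ∘ₗ (assoc k (H ⊗[k] H) H H).toLinearMap) f (by rfl)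
  have hS := conv_map_eq_one Q.reassoc_mul_inv e
  have hc := congr(toConv (Q.reassocInv ∘ₗ map LinearMap.id Q.mul.toLinearMap ∘ₗ
        (assoc k (H ⊗[k] H) H H).toLinearMap) * $(Q.cocycle) *
        toConv (Bicomod.tensorCounit Q.reassocInv))
  rw [← mul_assoc _ _ (toConv (Q.reassoc ∘ₗ map (map _ _) _)), hA, one_mul] at hc
  rw [hc]
  simp only [mul_assoc]
  rw [hS, mul_one]

theorem reassocInv_tmul_unit (g h : H) :
    Q.reassocInv ((g ⊗ₜ h) ⊗ₜ Q.unit 1) = counit (R := k) g * counit (R := k) h := by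
  have := congr($(reassocInv_unit_right (k := k) (H := H)) ((g ⊗ₜ h) ⊗ₜ 1))
  simpa [mul_comm] using this

theorem left_over_mul : LeftCoaction.Over Q.mul.toLinearMap Q.mul.toLinearMap
    (LeftCoaction.regular.tensor LeftCoaction.regular) (LeftCoaction.regular (k := k) (C := H)) :=
  Q.mul.map_comp_comul.symm

/-! ### Right dual quasi-Hopf bicomodules -/

namespace HopfBicomod

variable (M : HopfBicomod k H)

/-- The action `M ⊗ H → M` of a right dual quasi-Hopf bicomodule as a linear map. -/
def actLin : M.X.carrier ⊗[k] H →ₗ[k] M.X.carrier := Bicomod.Hom.toLin M.act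

theorem actLin_unit (x : M.X.carrier) : actLin M (x ⊗ₜ Q.unit 1) = x := by
  have h := congr(Bicomod.Hom.toLin $(M.act_one) (x ⊗ₜ[k] (1 : k)))
  exact h.trans (one_smul k x)

/-- The associativity of the action, `(xh)l = ω⁻¹(x₋₁ ⊗ h₁ ⊗ l₁) x₀(h₂l₂) ω(x₁ ⊗ h₃ ⊗ l₃)`. -/
theorem actLin_actLin (y : (M.X.carrier ⊗[k] H) ⊗[k] H) :
    actLin M (map (actLin M) LinearMap.id y) = actLin M (map LinearMap.id Q.mul.toLinearMap
      (Bicomod.assocLin M.X (Bicomod.regular k H) (Bicomod.regular k H) y)) :=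
  congr(Bicomod.Hom.toLin $(M.act_assoc) y)

theorem left_over_actLin : LeftCoaction.Over Q.mul.toLinearMap (actLin M)
    (M.X.left.tensor LeftCoaction.regular) M.X.left := by
  have h := M.act.left_colinear
  refine h.trans ?_
  change map LinearMap.id (actLin M) ∘ₗ (map Q.mul.toLinearMap LinearMap.id ∘ₗ
    (M.X.left.tensor LeftCoaction.regular).toLin) = _
  rw [← LinearMap.comp_assoc, ← TensorProduct.map_comp, LinearMap.id_comp, LinearMap.comp_id]

theorem right_over_actLin : RightCoaction.Over Q.mul.toLinearMap (actLin M)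
    (M.X.right.tensor RightCoaction.regular) M.X.right := by
  have h := M.act.right_colinear
  refine h.trans ?_
  change map (actLin M) LinearMap.id ∘ₗ (map LinearMap.id Q.mul.toLinearMap ∘ₗ
    (M.X.right.tensor RightCoaction.regular).toLin) = _
  rw [← LinearMap.comp_assoc, ← TensorProduct.map_comp, LinearMap.id_comp, LinearMap.comp_id]

/-- `(xh)₀ ⊗ (xh)₁ = x h₁ ⊗ h₂` for coinvariant `x`. -/
theorem right_actLin {x : M.X.carrier} (hx : x ∈ coinv M.X) (h : H) :
    M.X.right.toLin (actLin M (x ⊗ₜ h)) =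
      map (actLin M) LinearMap.id ((assoc k _ _ _).symm (x ⊗ₜ[k] comul (R := k) h)) := by
  have e := congr($(right_over_actLin M) (x ⊗ₜ h))
  refine e.trans ?_
  simp only [RightCoaction.tensor, RightCoaction.regular, LinearMap.comp_apply,
    TensorProduct.map_tmul, mem_coinv.1 hx, LinearEquiv.coe_coe]
  induction comul (R := k) h using tensor_ind with
  | add x y hx hy => simp only [map_add, TensorProduct.tmul_add, hx, hy]
  | tmul c x => simp [Q.unit_mul]

end HopfBicomod

/-! ### The map `m ↦ (m₀ ⊗ S(m₁)) ⊗ m₂` -/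

section Twist

variable {M : Type u} [AddCommGroup M] [Module k M] (r : RightCoaction k H M) (S : H →ₗ[k] H)

/-- `h ↦ S(h₁) ⊗ h₂` -/
def leftTwist : H →ₗ[k] H ⊗[k] H := map S LinearMap.id ∘ₗ comul

/-- `m ↦ m₀ ⊗ S(m₁)` -/
def rightTwist : M →ₗ[k] M ⊗[k] H := map LinearMap.id S ∘ₗ r.toLin

/-- `m ↦ (m₀ ⊗ S(m₁)) ⊗ m₂` -/
def twist : M →ₗ[k] (M ⊗[k] H) ⊗[k] H := map (rightTwist r S) LinearMap.id ∘ₗ r.toLin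

theorem twist_apply (m : M) : twist r S m = map (rightTwist r S) LinearMap.id (r.toLin m) := rfl

theorem assoc_twist (m : M) :
    assoc k M H H (twist r S m) = map LinearMap.id (leftTwist S) (r.toLin m) := by
  have h := congr(map LinearMap.id (map S LinearMap.id) ($(r.coassoc) m))
  simp only [LinearMap.comp_apply, LinearEquiv.coe_coe, TensorProduct.map_map,
    LinearMap.id_comp] at h
  refine .trans ?_ h
  rw [twist_apply]
  induction r.toLin m using tensor_ind with
  | add x y hx hy => simp only [map_add, hx, hy]
  | tmul x c =>
    simp only [TensorProduct.map_tmul, LinearMap.id_apply, rightTwist, LinearMap.comp_apply]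
    induction r.toLin x using tensor_ind with
    | add x y hx hy => simp only [map_add, TensorProduct.add_tmul, hx, hy]
    | tmul x d => simp

theorem twist_eq (m : M) :
    twist r S m = (assoc k M H H).symm (map LinearMap.id (leftTwist S) (r.toLin m)) := by
  rw [← assoc_twist, LinearEquiv.symm_apply_apply]

end Twist

/-- The codiagonal left coaction on `S(h₁) ⊗ h₂` is
`S(h₁)₁ h₂ ⊗ (S(h₁)₂ ⊗ h₃)`. -/
theorem left_leftTwist_eq (S : H →ₗ[k] H) (h : H) :
    ((LeftCoaction.regular.tensor LeftCoaction.regular).push Q.mul).toLin (leftTwist S h) =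
      assoc k H H H (map (map Q.mul.toLinearMap LinearMap.id ∘ₗ
        (TensorProduct.rightComm k H H H).toLinearMap ∘ₗ map (comul ∘ₗ S) LinearMap.id ∘ₗ comul)
        LinearMap.id (comul (R := k) h)) := by
  let K : (H ⊗[k] H) ⊗[k] H →ₗ[k] H ⊗[k] (H ⊗[k] H) := (assoc k H H H).toLinearMap ∘ₗ
    map (map Q.mul.toLinearMap LinearMap.id ∘ₗ (TensorProduct.rightComm k H H H).toLinearMap ∘ₗ
      map (comul ∘ₗ S) LinearMap.id) LinearMap.id
  have e := congr(K $(Coalgebra.coassoc_symm_apply (R := k) h))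
  refine (Eq.trans ?_ e).trans ?_
  · simp only [leftTwist, LeftCoaction.push, LeftCoaction.tensor, LeftCoaction.regular,
      LinearMap.comp_apply, LinearEquiv.coe_coe, LinearMap.lTensor]
    induction comul (R := k) h using tensor_ind with
    | add x y hx hy => simp only [map_add, hx, hy]
    | tmul a b =>
      simp only [TensorProduct.map_tmul, LinearMap.id_apply]
      induction comul (R := k) b using tensor_ind with
      | add x y hx hy => simp only [map_add, TensorProduct.tmul_add, hx, hy]
      | tmul b c =>
        simp only [K, LinearMap.comp_apply, LinearEquiv.coe_coe, TensorProduct.map_tmul,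
          TensorProduct.assoc_symm_tmul, LinearMap.id_apply]
        induction comul (R := k) (S a) using tensor_ind with
        | add x y hx hy => simp only [map_add, TensorProduct.add_tmul, hx, hy]
        | tmul a a' => simp
  · simp only [K, LinearMap.comp_apply, LinearMap.rTensor, TensorProduct.map_map,
      LinearEquiv.coe_coe, LinearMap.id_comp, LinearMap.comp_assoc]

/-- The codiagonal right coaction on `m₀ ⊗ S(m₁)` is
`(m₀ ⊗ S(m₂)₁) ⊗ m₁ S(m₂)₂`. -/
theorem right_rightTwist_eq {M : Type u} [AddCommGroup M] [Module k M]
    (r : RightCoaction k H M) (S : H →ₗ[k] H) (m : M) :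
    ((r.tensor RightCoaction.regular).push Q.mul).toLin (rightTwist r S m) =
      (assoc k M H H).symm (map LinearMap.id (map LinearMap.id Q.mul.toLinearMap ∘ₗ
        (TensorProduct.leftComm k H H H).toLinearMap ∘ₗ map LinearMap.id (comul ∘ₗ S) ∘ₗ comul)
        (r.toLin m)) := by
  let K : M ⊗[k] (H ⊗[k] H) →ₗ[k] (M ⊗[k] H) ⊗[k] H := (assoc k M H H).symm.toLinearMap ∘ₗ
    map LinearMap.id (map LinearMap.id Q.mul.toLinearMap ∘ₗ
      (TensorProduct.leftComm k H H H).toLinearMap ∘ₗ map LinearMap.id (comul ∘ₗ S))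
  have e := congr(K ($(r.coassoc) m))
  refine (Eq.trans ?_ e).trans ?_
  · simp only [rightTwist, RightCoaction.push, RightCoaction.tensor, RightCoaction.regular,
      LinearMap.comp_apply, LinearEquiv.coe_coe]
    induction r.toLin m using tensor_ind with
    | add x y hx hy => simp only [map_add, hx, hy]
    | tmul x b =>
      simp only [TensorProduct.map_tmul, LinearMap.id_apply]
      induction r.toLin x using tensor_ind with
      | add x y hx hy => simp only [map_add, TensorProduct.add_tmul, hx, hy]
      | tmul x a =>
        simp only [K, LinearMap.comp_apply, LinearEquiv.coe_coe, TensorProduct.map_tmul,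
          TensorProduct.assoc_tmul, LinearMap.id_apply]
        induction comul (R := k) (S b) using tensor_ind with
        | add x y hx hy => simp only [map_add, TensorProduct.tmul_add, hx, hy]
        | tmul a a' => simp
  · simp only [K, LinearMap.comp_apply, TensorProduct.map_map,
      LinearEquiv.coe_coe, LinearMap.id_comp, LinearMap.comp_assoc]

namespace IsPreantipode

variable {S : H →ₗ[k] H}

theorem reassoc_twist (hS : IsPreantipode S) (h : H) :
    Q.reassoc (twist RightCoaction.regular S h) = counit (R := k) h :=
  hS.reassoc_eq h

/-- The elements `S(h₁) ⊗ h₂` are coinvariant for the codiagonal left coaction. -/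
theorem left_leftTwist (hS : IsPreantipode S) (h : H) :
    ((LeftCoaction.regular.tensor LeftCoaction.regular).push Q.mul).toLin (leftTwist S h) =
      Q.unit 1 ⊗ₜ[k] leftTwist S h := by
  rw [left_leftTwist_eq]
  simp only [leftTwist, LinearMap.comp_apply]
  induction comul (R := k) h using tensor_ind with
  | add x y hx hy => simp only [map_add, TensorProduct.tmul_add, hx, hy]
  | tmul a b =>
    simp only [LinearMap.comp_apply, LinearEquiv.coe_coe, TensorProduct.map_tmul,
      LinearMap.id_apply]
    rw [hS.left_colinear a, TensorProduct.assoc_tmul]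

/-- The elements `m₀ ⊗ S(m₁)` are coinvariant for the codiagonal right coaction. -/
theorem right_rightTwist (hS : IsPreantipode S) {M : Type u} [AddCommGroup M] [Module k M]
    (r : RightCoaction k H M) (m : M) :
    ((r.tensor RightCoaction.regular).push Q.mul).toLin (rightTwist r S m) =
      rightTwist r S m ⊗ₜ[k] Q.unit 1 := by
  rw [right_rightTwist_eq]
  simp only [rightTwist, LinearMap.comp_apply]
  induction r.toLin m using tensor_ind with
  | add x y hx hy => simp only [map_add, TensorProduct.add_tmul, hx, hy]
  | tmul x b =>
    simp only [LinearMap.comp_apply, LinearEquiv.coe_coe, TensorProduct.map_tmul,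
      LinearMap.id_apply]
    rw [hS.right_colinear b, TensorProduct.assoc_symm_tmul]

end IsPreantipode

/-! ### The inverse of the counit defined by a preantipode -/

/-- If `z ∈ H ⊗ H` is coinvariant for the codiagonal right coaction, then
`φ(z₁ ⊗ n₋₁) m(z₂) ⊗ n₀ = 1 ⊗ φ(z ⊗ n₋₁) n₀`. -/
theorem mul_tensor_act {D N : Type u} [AddCommGroup D] [Module k D] [Coalgebra k D]
    [AddCommGroup N] [Module k N] (l : LeftCoaction k D N) (φ : (H ⊗[k] H) ⊗[k] D →ₗ[k] k)
    {z : H ⊗[k] H}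
    (hz : ((RightCoaction.regular.tensor RightCoaction.regular).push Q.mul).toLin z =
      z ⊗ₜ[k] Q.unit 1) (n : N) :
    map Q.mul.toLinearMap LinearMap.id
      (((LeftCoaction.regular.tensor LeftCoaction.regular).tensor l).act φ (z ⊗ₜ n)) =
      Q.unit 1 ⊗ₜ[k] l.act (φ ∘ₗ TensorProduct.mk k (H ⊗[k] H) D z) n := by
  change map LinearMap.id Q.mul.toLinearMap
    ((LeftCoaction.regular.tensor LeftCoaction.regular).toLin z) = _ at hz
  simp only [LeftCoaction.act, LinearMap.comp_apply, LinearEquiv.coe_coe]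
  rw [LeftCoaction.tensor]
  simp only [LinearMap.comp_apply, TensorProduct.map_tmul, LinearEquiv.coe_coe]
  induction l.toLin n using tensor_ind with
  | add x y hx hy => simp only [map_add, TensorProduct.tmul_add, hx, hy]
  | tmul d y =>
    let G : (H ⊗[k] H) ⊗[k] H →ₗ[k] H ⊗[k] N := (lid k _).toLinearMap ∘ₗ
      map (φ ∘ₗ (TensorProduct.mk k _ D).flip d) ((TensorProduct.mk k H N).flip y)
    refine .trans ?_ (congr(G $hz).trans (by simp [G]))
    induction (LeftCoaction.regular.tensor LeftCoaction.regular).toLin z using tensor_ind with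
    | add x y hx hy => simp only [map_add, TensorProduct.add_tmul, hx, hy]
    | tmul a b => simp [G, TensorProduct.smul_tmul']

/-- If `p ∈ H ⊗ H` is coinvariant for the codiagonal left coaction, then
`x₀ ⊗ m(p₁) φ(x₁ ⊗ p₂) = x₀ φ(x₁ ⊗ p) ⊗ 1`. -/
theorem tensor_mul_act {C M : Type u} [AddCommGroup C] [Module k C] [Coalgebra k C]
    [AddCommGroup M] [Module k M] (r : RightCoaction k C M) (φ : C ⊗[k] (H ⊗[k] H) →ₗ[k] k)
    {p : H ⊗[k] H}
    (hp : ((LeftCoaction.regular.tensor LeftCoaction.regular).push Q.mul).toLin p =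
      Q.unit 1 ⊗ₜ[k] p) (x : M) :
    map LinearMap.id Q.mul.toLinearMap
      ((r.tensor (RightCoaction.regular.tensor RightCoaction.regular)).act φ (x ⊗ₜ p)) =
      r.act (φ ∘ₗ (TensorProduct.mk k C (H ⊗[k] H)).flip p) x ⊗ₜ[k] Q.unit 1 := by
  change map Q.mul.toLinearMap LinearMap.id
    ((RightCoaction.regular.tensor RightCoaction.regular).toLin p) = _ at hp
  simp only [RightCoaction.act, LinearMap.comp_apply, LinearEquiv.coe_coe]
  rw [RightCoaction.tensor]
  simp only [LinearMap.comp_apply, TensorProduct.map_tmul, LinearEquiv.coe_coe]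
  induction r.toLin x using tensor_ind with
  | add x y hx hy => simp only [map_add, TensorProduct.add_tmul, hx, hy]
  | tmul y c =>
    let G : H ⊗[k] (H ⊗[k] H) →ₗ[k] M ⊗[k] H := (rid k _).toLinearMap ∘ₗ
      map (TensorProduct.mk k M H y) (φ ∘ₗ TensorProduct.mk k C _ c)
    refine .trans ?_ (congr(G $hp).trans (by simp [G, TensorProduct.smul_tmul']))
    induction (RightCoaction.regular.tensor RightCoaction.regular).toLin p using tensor_ind with
    | add x y hx hy => simp only [map_add, TensorProduct.tmul_add, hx, hy]
    | tmul a b => simp [G, TensorProduct.smul_tmul']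

namespace IsPreantipode

variable {S : H →ₗ[k] H}

/-- `ω(h₁ ⊗ S(h₃)₁ ⊗ h₄) h₂ S(h₃)₂ ⊗ h₅ = 1 ⊗ h` -/
theorem mul_act_twist (hS : IsPreantipode S) (h : H) :
    map Q.mul.toLinearMap LinearMap.id
      (((LeftCoaction.regular.tensor LeftCoaction.regular).tensor LeftCoaction.regular).act
        Q.reassoc (twist RightCoaction.regular S h)) = Q.unit 1 ⊗ₜ[k] h := by
  let K : H ⊗[k] (H ⊗[k] H) →ₗ[k] H := (lid k H).toLinearMap ∘ₗ
    map (Q.reassoc ∘ₗ map (rightTwist RightCoaction.regular S) LinearMap.id) LinearMap.id ∘ₗ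
    (assoc k H H H).symm.toLinearMap
  have e1 : K (map LinearMap.id comul (comul (R := k) h)) = h := by
    refine congr(K $(Coalgebra.coassoc_apply (R := k) h)).symm.trans ?_
    refine .trans ?_ (congr(lid k H $(Coalgebra.rTensor_counit_comul (R := k) h)).trans (by simp))
    simp only [LinearMap.rTensor]
    induction comul (R := k) h using tensor_ind with
    | add x y hx hy => simp only [map_add, hx, hy]
    | tmul x y =>
      have := hS.reassoc_twist x
      rw [twist_apply, RightCoaction.regular] at this
      simp only [K, LinearMap.comp_apply, LinearEquiv.coe_coe, LinearEquiv.symm_apply_apply,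
        TensorProduct.map_tmul, LinearMap.id_apply]
      rw [← this]
      rfl
  refine .trans ?_ congr(Q.unit 1 ⊗ₜ[k] $e1)
  have e2 : ∀ t : H ⊗[k] H, map Q.mul.toLinearMap LinearMap.id
      (((LeftCoaction.regular.tensor LeftCoaction.regular).tensor LeftCoaction.regular).act
        Q.reassoc (map (rightTwist RightCoaction.regular S) LinearMap.id t)) =
      Q.unit 1 ⊗ₜ[k] K (map LinearMap.id comul t) := by
    intro t
    induction t using tensor_ind with
    | add x y hx hy => simp only [map_add, TensorProduct.tmul_add, hx, hy]
    | tmul x y =>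
      rw [TensorProduct.map_tmul, mul_tensor_act _ _ (hS.right_rightTwist _ x)]
      simp only [LeftCoaction.act, LeftCoaction.regular, LinearMap.comp_apply, LinearEquiv.coe_coe,
        LinearMap.id_apply, TensorProduct.map_tmul]
      congr 1
      induction comul (R := k) y using tensor_ind with
      | add x y hx hy => simp only [map_add, TensorProduct.tmul_add, hx, hy]
      | tmul b c => simp [K, RightCoaction.regular]
  exact e2 _

/-- `m₀ ⊗ S(m₂)₁ m₃ ω(m₁ ⊗ S(m₂)₂ ⊗ m₄) = m ⊗ 1` -/
theorem mul_act_right_twist (hS : IsPreantipode S) {M : Type u} [AddCommGroup M] [Module k M]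
    (r : RightCoaction k H M) (m : M) :
    map LinearMap.id Q.mul.toLinearMap (assoc k M H H
      (((r.tensor RightCoaction.regular).tensor RightCoaction.regular).act Q.reassoc
        (twist r S m))) = m ⊗ₜ[k] Q.unit 1 := by
  have e0 := (RightCoaction.Over.assoc r (RightCoaction.regular (k := k) (C := H))
    (RightCoaction.regular (k := k) (C := H))).act
    (Q.reassoc ∘ₗ (assoc k H H H).symm.toLinearMap) (twist r S m)
  rw [LinearMap.comp_assoc, LinearEquiv.symm_comp, LinearMap.comp_id] at e0
  simp only [LinearEquiv.coe_coe] at e0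
  rw [← e0, assoc_twist]
  let K : M ⊗[k] (H ⊗[k] H) →ₗ[k] M := (rid k M).toLinearMap ∘ₗ
    map LinearMap.id (Q.reassoc ∘ₗ (assoc k H H H).symm.toLinearMap ∘ₗ
      map LinearMap.id (leftTwist S))
  have e1 : K (assoc k M H H (map r.toLin LinearMap.id (r.toLin m))) = m := by
    refine congr(K ($(r.coassoc) m)).trans (.trans ?_ (r.act_counit m))
    simp only [LinearMap.comp_apply, RightCoaction.act, LinearEquiv.coe_coe]
    induction r.toLin m using tensor_ind with
    | add x y hx hy => simp only [map_add, hx, hy]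
    | tmul x y =>
      have := hS.reassoc_twist y
      rw [← (assoc k H H H).symm_apply_apply (twist _ S y), assoc_twist] at this
      simp only [K, LinearMap.comp_apply, LinearEquiv.coe_coe,
        TensorProduct.map_tmul, LinearMap.id_apply]
      rw [← this]
      rfl
  refine .trans ?_ congr($e1 ⊗ₜ[k] Q.unit 1)
  have e2 : ∀ t : M ⊗[k] H, map LinearMap.id Q.mul.toLinearMap
      ((r.tensor (RightCoaction.regular.tensor RightCoaction.regular)).act
        (Q.reassoc ∘ₗ (assoc k H H H).symm.toLinearMap)
        (map LinearMap.id (leftTwist S) t)) =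
      K (assoc k M H H (map r.toLin LinearMap.id t)) ⊗ₜ[k] Q.unit 1 := by
    intro t
    induction t using tensor_ind with
    | add x y hx hy => simp only [map_add, TensorProduct.add_tmul, hx, hy]
    | tmul x y =>
      rw [TensorProduct.map_tmul, tensor_mul_act _ _ (hS.left_leftTwist y)]
      simp only [RightCoaction.act, LinearMap.comp_apply, LinearEquiv.coe_coe,
        LinearMap.id_apply, TensorProduct.map_tmul]
      congr 1
      induction r.toLin x using tensor_ind with
      | add x y hx hy => simp only [map_add, TensorProduct.add_tmul, hx, hy]
      | tmul b c => simp [K]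
  exact e2 _

variable (S) in
/-- `m ↦ (ω(m₋₁ ⊗ S(m₁)₁ ⊗ m₂) m₀ S(m₁)₂) ⊗ m₃`, the inverse of the counit when `S` is a
preantipode. -/
def counitInv (M : HopfBicomod k H) : M.X.carrier →ₗ[k] M.X.carrier ⊗[k] H :=
  map (HopfBicomod.actLin M) LinearMap.id ∘ₗ
    (Bicomod.left3 M.X (Bicomod.regular k H) (Bicomod.regular k H)).act Q.reassoc ∘ₗ
    twist M.X.right S

theorem actLin_counitInv (hS : IsPreantipode S) (M : HopfBicomod k H) (m : M.X.carrier) :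
    HopfBicomod.actLin M (counitInv S M m) = m := by
  simp only [counitInv, LinearMap.comp_apply]
  rw [HopfBicomod.actLin_actLin]
  simp only [Bicomod.assocLin, LinearMap.comp_apply, LinearEquiv.coe_coe]
  -- the `ω⁻¹` of the associativity constraint cancels the `ω` in the definition of `counitInv`
  rw [LeftCoaction.act_act, Q.reassoc_mul_inv, LeftCoaction.act_one]
  rw [hS.mul_act_right_twist, HopfBicomod.actLin_unit]

theorem counitInv_mem_range (hS : IsPreantipode S) (M : HopfBicomod k H) (m : M.X.carrier) :
    counitInv S M m ∈
      LinearMap.range (map (coinv M.X).subtype (LinearMap.id : H →ₗ[k] H)) := by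
  -- before the multiplication, the element already lies in `(M ⊗ H)^{co H} ⊗ H`
  have h1 : ∀ t : M.X.carrier ⊗[k] H,
      (Bicomod.left3 M.X (Bicomod.regular k H) (Bicomod.regular k H)).act Q.reassoc
        (map (rightTwist M.X.right S) LinearMap.id t) ∈ LinearMap.range
        (map (coinv (Bicomod.tensor M.X (Bicomod.regular k H))).subtype
          (LinearMap.id : H →ₗ[k] H)) := by
    intro t
    induction t using tensor_ind with
    | add x y hx hy =>
      simp only [map_add]
      exact Submodule.add_mem _ hx hy
    | tmul x a =>
      rw [TensorProduct.map_tmul]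
      refine LeftCoaction.tensor_act_mem_range _ _ _ _ ?_
        (mem_coinv.2 (hS.right_rightTwist M.X.right x)) _
      -- left functionals preserve right coinvariants, since the two coactions commute
      intro ψ z hz
      rw [mem_coinv] at hz ⊢
      have hc := ((M.X.commute.tensor (Bicomod.regular k H).commute).toLin_act_left ψ z)
      have := congr(map LinearMap.id Q.mul.toLinearMap $hc)
      refine this.trans ?_
      have h2 := congr(map ((M.X.left.tensor LeftCoaction.regular).act ψ) LinearMap.id $hz)
      refine .trans ?_ h2
      simp only [RightCoaction.push, LinearMap.comp_apply, TensorProduct.map_map,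
        LinearMap.comp_id, LinearMap.id_comp]
  obtain ⟨t, ht⟩ := h1 (M.X.right.toLin m)
  refine ⟨map ((HopfBicomod.actLin M).restrict (coinv_map M.act)) LinearMap.id t, ?_⟩
  refine .trans ?_ congr(map (HopfBicomod.actLin M) LinearMap.id $ht)
  rw [TensorProduct.map_map, TensorProduct.map_map]
  rfl

end IsPreantipode

/-- `x ⊗ ((a ⊗ b) ⊗ c) ↦ ((x ⊗ a) ⊗ b) ⊗ c` -/
def reassociate (M : Type u) [AddCommGroup M] [Module k M] :
    M ⊗[k] ((H ⊗[k] H) ⊗[k] H) →ₗ[k] ((M ⊗[k] H) ⊗[k] H) ⊗[k] H :=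
  map (assoc k M H H).symm.toLinearMap LinearMap.id ∘ₗ
    (assoc k M (H ⊗[k] H) H).symm.toLinearMap

/-- For coinvariant `x`, `twist S` maps `xh` to `(x h₁ ⊗ S(h₂)) ⊗ h₃`. -/
theorem twist_actLin (S : H →ₗ[k] H) (M : HopfBicomod k H) {x : M.X.carrier}
    (hx : x ∈ coinv M.X) (h : H) :
    twist M.X.right S (HopfBicomod.actLin M (x ⊗ₜ h)) =
      map (map (HopfBicomod.actLin M) LinearMap.id) LinearMap.id
        (reassociate M.X.carrier (x ⊗ₜ twist RightCoaction.regular S h)) := by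
  have e' : twist RightCoaction.regular S h =
      (assoc k H H H).symm (map LinearMap.id (leftTwist S) (comul h)) :=
    twist_eq RightCoaction.regular S h
  rw [twist_eq, HopfBicomod.right_actLin M hx, e']
  have e2 : ∀ t : H ⊗[k] H, (assoc k M.X.carrier H H).symm (map LinearMap.id (leftTwist S)
        (map (HopfBicomod.actLin M) LinearMap.id ((assoc k _ _ _).symm (x ⊗ₜ[k] t)))) =
      map (map (HopfBicomod.actLin M) LinearMap.id) LinearMap.id (reassociate M.X.carrier (x ⊗ₜ
        (assoc k H H H).symm (map LinearMap.id (leftTwist S) t))) := by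
    intro t
    induction t using tensor_ind with
    | add x y hx hy => simp only [map_add, TensorProduct.tmul_add, hx, hy]
    | tmul a b =>
      simp only [TensorProduct.map_tmul, TensorProduct.assoc_symm_tmul, LinearMap.id_apply]
      induction leftTwist S b using tensor_ind with
      | add x y hx hy => simp only [map_add, TensorProduct.tmul_add, hx, hy]
      | tmul a b => simp [reassociate]
  exact e2 _

/-- `ω ⊗ ε` acts trivially on `((x ⊗ h₁) ⊗ S(h₂)) ⊗ h₃` if `x` is coinvariant. -/
theorem right_act_twist (S : H →ₗ[k] H) (M : Bicomod k H) {x : M.carrier} (hx : x ∈ coinv M)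
    (h : H) :
    (Bicomod.right4 M (Bicomod.regular k H) (Bicomod.regular k H) (Bicomod.regular k H)).act
      (Bicomod.tensorCounit Q.reassoc)
      (reassociate M.carrier (x ⊗ₜ twist RightCoaction.regular S h)) =
      reassociate M.carrier (x ⊗ₜ twist RightCoaction.regular S h) := by
  rw [← RightCoaction.act_tensor, Bicomod.act_counit_eq_id']
  generalize twist RightCoaction.regular S h = w
  induction w using tensor_ind with
  | add x y hx hy => simp only [map_add, TensorProduct.tmul_add, hx, hy]
  | tmul a c =>
    induction a using tensor_ind with
    | add x y hx hy => simp only [map_add, TensorProduct.tmul_add, TensorProduct.add_tmul, hx, hy]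
    | tmul a b =>
      let R := RightCoaction.regular (k := k) (C := H)
      have h0 : RightCoaction.Over Q.unit.toLinearMap (LinearMap.toSpanSingleton k M.carrier x)
          (RightCoaction.base (k := k) (M := k)) M.right := by
        unfold RightCoaction.Over
        ext
        simpa [RightCoaction.base] using mem_coinv.1 hx
      have e := ((h0.tensor (RightCoaction.Over.id R)).tensor (RightCoaction.Over.id R)).act
        Q.reassoc ((1 ⊗ₜ a) ⊗ₜ b)
      rw [reassoc_unit_left, RightCoaction.act_counit] at e
      simp only [TensorProduct.map_tmul, LinearMap.id_apply,
        LinearMap.toSpanSingleton_apply, one_smul] at e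
      simp only [reassociate, LinearMap.comp_apply, LinearEquiv.coe_coe,
        TensorProduct.assoc_symm_tmul, TensorProduct.map_tmul, LinearMap.id_apply]
      exact congr($e ⊗ₜ[k] c)

/-- `ω` acts trivially on `(x ⊗ 1) ⊗ h`. -/
theorem act_tmul_unit (M : Bicomod k H) (x : M.carrier) (h : H) :
    (Bicomod.left3 M (Bicomod.regular k H) (Bicomod.regular k H)).act Q.reassoc
      ((x ⊗ₜ Q.unit 1) ⊗ₜ h) = (x ⊗ₜ Q.unit 1) ⊗ₜ h := by
  have hl := ((LeftCoaction.Over.id M.left).tensor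
    (LeftCoaction.Over.push Q.unit (LeftCoaction.base (k := k) (M := k)))).tensor
    (LeftCoaction.Over.id (LeftCoaction.regular (k := k) (C := H)))
  have h1 : LeftCoaction.Over LinearMap.id Q.unit.toLinearMap
      ((LeftCoaction.base (k := k) (M := k)).push Q.unit)
      (LeftCoaction.regular (k := k) (C := H)) :=
    (MonObj.one (X := Bicomod.regular k H)).left_colinear
  have hu := ((LeftCoaction.Over.id M.left).tensor h1).tensor
    (LeftCoaction.Over.id (LeftCoaction.regular (k := k) (C := H)))
  have e := (hu.comp hl).act Q.reassoc ((x ⊗ₜ 1) ⊗ₜ h)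
  simp only [TensorProduct.map_id, LinearMap.id_comp, LinearMap.comp_id] at e
  rw [Bicomod.reassoc_comp_unit, LeftCoaction.act_counit] at e
  exact e

namespace IsPreantipode

variable {S : H →ₗ[k] H}

/-- `ω⁻¹(H ⊗ H ⊗ m)` acts trivially on `((x ⊗ h₁) ⊗ S(h₂)) ⊗ h₃`. -/
theorem act_mul_twist (hS : IsPreantipode S) (M : Bicomod k H) (x : M.carrier) (h : H) :
    (Bicomod.left4 M (Bicomod.regular k H) (Bicomod.regular k H) (Bicomod.regular k H)).act
      (Q.reassocInv ∘ₗ map LinearMap.id Q.mul.toLinearMap ∘ₗ (assoc k (H ⊗[k] H) H H).toLinearMap)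
      (reassociate M.carrier (x ⊗ₜ twist RightCoaction.regular S h)) =
      reassociate M.carrier (x ⊗ₜ twist RightCoaction.regular S h) := by
  let R := LeftCoaction.regular (k := k) (C := H)
  have hl := ((LeftCoaction.Over.id (M.left.tensor R)).tensor
    (LeftCoaction.Over.push Q.mul (R.tensor R))).comp
    (LeftCoaction.Over.assoc (M.left.tensor R) R R)
  simp only [TensorProduct.map_id, LinearMap.id_comp] at hl
  have e := hl.act Q.reassocInv (reassociate M.carrier (x ⊗ₜ twist RightCoaction.regular S h))
  apply (assoc k (M.carrier ⊗[k] H) H H).injective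
  refine e.symm.trans ?_
  have e' : twist RightCoaction.regular S h =
      (assoc k H H H).symm (map LinearMap.id (leftTwist S) (comul h)) :=
    twist_eq RightCoaction.regular S h
  have e3 : ∀ t : H ⊗[k] (H ⊗[k] H), assoc k (M.carrier ⊗[k] H) H H
      (reassociate M.carrier (x ⊗ₜ (assoc k H H H).symm t)) =
        (assoc k M.carrier H (H ⊗[k] H)).symm (x ⊗ₜ t) := by
    intro t
    induction t using tensor_ind with
    | add x y hx hy => simp only [map_add, TensorProduct.tmul_add, hx, hy]
    | tmul a b =>
      induction b using tensor_ind with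
      | add x y hx hy => simp only [map_add, TensorProduct.tmul_add, hx, hy]
      | tmul a b => simp [reassociate]
  rw [e']
  simp only [LinearEquiv.coe_coe]
  rw [e3]
  have e4 : ∀ t : H ⊗[k] H,
      ((M.left.tensor R).tensor ((R.tensor R).push Q.mul)).act Q.reassocInv
        ((assoc k M.carrier H (H ⊗[k] H)).symm (x ⊗ₜ map LinearMap.id (leftTwist S) t)) =
      (assoc k M.carrier H (H ⊗[k] H)).symm (x ⊗ₜ map LinearMap.id (leftTwist S) t) := by
    intro t
    induction t using tensor_ind with
    | add x y hx hy => simp only [map_add, TensorProduct.tmul_add, hx, hy]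
    | tmul a b =>
      rw [TensorProduct.map_tmul, TensorProduct.assoc_symm_tmul,
        LeftCoaction.tensor_act_tmul _ _ _ _ (hS.left_leftTwist b)]
      have : Q.reassocInv ∘ₗ (TensorProduct.mk k (H ⊗[k] H) H).flip (Q.unit 1) = counit := by
        ext g h
        simpa [mul_comm] using reassocInv_tmul_unit (k := k) g h
      rw [this, LeftCoaction.act_counit]
  exact e4 _

/-- `ε ⊗ ω` followed by `ω(H ⊗ m ⊗ H)` and the multiplication of the two middle factors maps
`((x ⊗ h₁) ⊗ S(h₂)) ⊗ h₃` to `(x ⊗ 1) ⊗ h`. -/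
theorem mul_act_act_twist (hS : IsPreantipode S) (M : Bicomod k H) (x : M.carrier) (h : H) :
    map (map LinearMap.id Q.mul.toLinearMap ∘ₗ (assoc k M.carrier H H).toLinearMap) LinearMap.id
    ((Bicomod.left4 M (Bicomod.regular k H) (Bicomod.regular k H) (Bicomod.regular k H)).act
      (Q.reassoc ∘ₗ
        map (map LinearMap.id Q.mul.toLinearMap ∘ₗ (assoc k H H H).toLinearMap) LinearMap.id)
      ((Bicomod.left4 M (Bicomod.regular k H) (Bicomod.regular k H) (Bicomod.regular k H)).act
        (Bicomod.counitTensor Q.reassoc)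
        (reassociate M.carrier (x ⊗ₜ twist RightCoaction.regular S h)))) =
      (x ⊗ₜ Q.unit 1) ⊗ₜ h := by
  let R := LeftCoaction.regular (k := k) (C := H)
  have hR := (((LeftCoaction.Over.id M.left).tensor left_over_mul).comp
    (LeftCoaction.Over.assoc M.left R R)).tensor (LeftCoaction.Over.id R)
  rw [← act_tmul_unit]
  refine (hR.act Q.reassoc _).symm.trans ?_
  congr 1
  have hP := (LeftCoaction.Over.assoc M.left (R.tensor R) R).comp
    ((LeftCoaction.Over.assoc M.left R R).tensor (LeftCoaction.Over.id R))
  have e := hP.act (LinearMap.mul' k k ∘ₗ map counit Q.reassoc)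
    (reassociate M.carrier (x ⊗ₜ twist RightCoaction.regular S h))
  have e0 : ∀ t : M.carrier ⊗[k] ((H ⊗[k] H) ⊗[k] H),
      assoc k M.carrier (H ⊗[k] H) H (map (assoc k M.carrier H H).toLinearMap LinearMap.id
        (reassociate M.carrier t)) = t := by
    intro t
    simp only [reassociate, LinearMap.comp_apply, TensorProduct.map_map, LinearEquiv.comp_symm,
      LinearMap.id_comp, TensorProduct.map_id, LinearEquiv.coe_coe, LinearMap.id_apply,
      LinearEquiv.apply_symm_apply]
  simp only [LinearMap.comp_apply, LinearEquiv.coe_coe] at e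
  rw [e0, ← LeftCoaction.act_tensor, TensorProduct.map_tmul, LeftCoaction.act_counit] at e
  have e1 : ∀ t : ((M.carrier ⊗[k] H) ⊗[k] H) ⊗[k] H,
      map (map LinearMap.id Q.mul.toLinearMap ∘ₗ (assoc k M.carrier H H).toLinearMap)
        LinearMap.id t = (assoc k M.carrier H H).symm
          (map LinearMap.id (map Q.mul.toLinearMap LinearMap.id)
            (assoc k M.carrier (H ⊗[k] H) H
              (map (assoc k M.carrier H H).toLinearMap LinearMap.id t))) := by
    intro t
    have : map (map LinearMap.id Q.mul.toLinearMap ∘ₗ (assoc k M.carrier H H).toLinearMap)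
        LinearMap.id = (assoc k M.carrier H H).symm.toLinearMap ∘ₗ
          (map LinearMap.id (map Q.mul.toLinearMap LinearMap.id) ∘ₗ
            ((assoc k M.carrier (H ⊗[k] H) H).toLinearMap ∘ₗ
              (map (assoc k M.carrier H H).toLinearMap (LinearMap.id : H →ₗ[k] H)))) := by
      ext
      simp
    exact congr($this t)
  rw [e1]
  have e2 := congr((assoc k M.carrier H H).symm
          (map LinearMap.id (map Q.mul.toLinearMap LinearMap.id) $e))
  refine e2.symm.trans ?_
  rw [TensorProduct.map_tmul, hS.mul_act_twist, LinearMap.id_apply, TensorProduct.assoc_symm_tmul]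

/-- `counitInv` inverts the counit: it maps `xh` to `x ⊗ h` for coinvariant `x`. -/
theorem counitInv_actLin (hS : IsPreantipode S) (M : HopfBicomod k H) {x : M.X.carrier}
    (hx : x ∈ coinv M.X) (h : H) :
    counitInv S M (HopfBicomod.actLin M (x ⊗ₜ h)) = x ⊗ₜ h := by
  let R := LeftCoaction.regular (k := k) (C := H)
  -- left colinearity of the action turns `ω` on `(M ⊗ H) ⊗ H` into `ω(m ⊗ H ⊗ H)` on `W`
  have hμ := ((HopfBicomod.left_over_actLin M).tensor (LeftCoaction.Over.id R)).tensor
    (LeftCoaction.Over.id R)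
  simp only [counitInv, LinearMap.comp_apply]
  rw [twist_actLin S M hx]
  generalize hW : reassociate M.X.carrier (x ⊗ₜ twist RightCoaction.regular S h) = W
  refine congr(map (HopfBicomod.actLin M) LinearMap.id $(hμ.act Q.reassoc W)).trans ?_
  have e1 : ∀ t : ((M.X.carrier ⊗[k] H) ⊗[k] H) ⊗[k] H,
      map (HopfBicomod.actLin M) LinearMap.id
        (map (map (HopfBicomod.actLin M) LinearMap.id) LinearMap.id t) =
      map (HopfBicomod.actLin M) (LinearMap.id : H →ₗ[k] H)
        (map (map LinearMap.id Q.mul.toLinearMap) LinearMap.id (map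
          (Bicomod.assocLin M.X (Bicomod.regular k H) (Bicomod.regular k H))
            LinearMap.id t)) := by
    intro t
    simp only [TensorProduct.map_map, LinearMap.id_comp]
    congr 2
    exact LinearMap.ext (HopfBicomod.actLin_actLin M)
  have e2 := fun y => congr($(Bicomod.step1 M.X (Bicomod.regular k H) (Bicomod.regular k H)
    (Bicomod.regular k H)) y)
  simp only [LinearMap.comp_apply] at e2
  -- the left actions of `ω(m ⊗ H ⊗ H)` and `ω⁻¹ ⊗ ε` combine into their convolution product
  rw [e1, e2, LeftCoaction.act_act, cocycle_rearranged]
  have e3 := hS.act_mul_twist M.X x h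
  have e4 := right_act_twist S M.X hx h
  have e5 := hS.mul_act_act_twist M.X x h
  rw [hW] at e3 e4 e5
  have e6 := (LeftCoaction.act_act
    (Bicomod.left4 M.X (Bicomod.regular k H) (Bicomod.regular k H) (Bicomod.regular k H))
    (toConv (Bicomod.counitTensor Q.reassoc) * toConv (Q.reassoc ∘ₗ
      map (map LinearMap.id Q.mul.toLinearMap ∘ₗ (assoc k H H H).toLinearMap)
        LinearMap.id)).ofConv
    (Q.reassocInv ∘ₗ map LinearMap.id Q.mul.toLinearMap ∘ₗ
      (assoc k (H ⊗[k] H) H H).toLinearMap) W).symm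
  rw [e3] at e6
  have e7 := e6.trans (LeftCoaction.act_act _ _ _ W).symm
  rw [toConv_ofConv] at e7
  rw [e7, (Bicomod.commute4 _ _ _ _).act_comm, (Bicomod.commute4 _ _ _ _).act_comm, e4,
    ← LinearMap.comp_apply (map (map LinearMap.id _) _), ← TensorProduct.map_comp,
    LinearMap.id_comp, e5, TensorProduct.map_tmul, HopfBicomod.actLin_unit, LinearMap.id_apply]

end IsPreantipode

/-! ### Bijective morphisms are isomorphisms -/

theorem LeftComod.isIso_of_bijective {V W : LeftComod k H} (f : V ⟶ W)
    (hf : Function.Bijective (Hom.toLin f)) : IsIso f := by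
  let e := LinearEquiv.ofBijective _ hf
  have h1 : e.symm.toLinearMap ∘ₗ Hom.toLin f = LinearMap.id :=
    LinearMap.ext e.symm_apply_apply
  have h2 : Hom.toLin f ∘ₗ e.symm.toLinearMap = LinearMap.id :=
    LinearMap.ext e.apply_symm_apply
  refine ⟨⟨⟨e.symm.toLinearMap, ?_⟩, LeftComod.hom_ext h1, LeftComod.hom_ext h2⟩⟩
  have h := congr(map LinearMap.id e.symm.toLinearMap ∘ₗ $(f.left_colinear) ∘ₗ e.symm.toLinearMap)
  rw [LinearMap.comp_assoc, h2, LinearMap.comp_id, LinearMap.comp_assoc,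
    ← LinearMap.comp_assoc _ _ (map _ e.symm.toLinearMap), ← TensorProduct.map_comp, h1,
    LinearMap.id_comp, TensorProduct.map_id, LinearMap.id_comp] at h
  exact h.symm

/-- The isomorphism defined by a bijective bicomodule map. -/
def Bicomod.isoOfBijective {M N : Bicomod k H} (f : M ⟶ N)
    (hf : Function.Bijective (Hom.toLin f)) : M ≅ N :=
  Bicomod.isoMk f (LinearEquiv.ofBijective _ hf).symm.toLinearMap
    (LinearMap.ext (LinearEquiv.ofBijective _ hf).symm_apply_apply)
    (LinearMap.ext (LinearEquiv.ofBijective _ hf).apply_symm_apply)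

theorem Bicomod.isIso_iff_bijective {M N : Bicomod k H} (f : M ⟶ N) :
    IsIso f ↔ Function.Bijective (Hom.toLin f) := by
  refine ⟨fun _ => Function.bijective_iff_has_inverse.2 ⟨Hom.toLin (inv f), fun x => ?_,
    fun x => ?_⟩, fun hf => (Bicomod.isoOfBijective f hf).isIso_hom⟩
  · exact congr(Hom.toLin $(IsIso.hom_inv_id f) x)
  · exact congr(Hom.toLin $(IsIso.inv_hom_id f) x)

theorem RightMod.isIso_iff {C : Type*} [Category C] [MonoidalCategory C] {A : C} [MonObj A]
    {M N : RightMod A} (f : M ⟶ N) : IsIso f ↔ IsIso (Hom.hom f) := by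
  refine ⟨fun _ => Functor.map_isIso (forget A) f, fun _ => ?_⟩
  refine ⟨⟨⟨inv (Hom.hom f), ?_⟩, hom_ext (IsIso.hom_inv_id _), hom_ext (IsIso.inv_hom_id _)⟩⟩
  rw [IsIso.comp_inv_eq, Category.assoc, f.act_hom, ← Category.assoc, ← comp_whiskerRight]
  simp

/-! ### The unit and the counit of the adjunction -/

/-- The right coaction on `V ⊗ H` is `V ⊗ Δ`, if `V` carries the trivial right coaction. -/
theorem right_functorF (V : LeftComod k H) (v : V.carrier) (h : H) :
    ((functorF k H).obj V).X.right.toLin (v ⊗ₜ[k] h) =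
      (assoc k V.carrier H H).symm (v ⊗ₜ[k] comul (R := k) h) := by
  change map LinearMap.id Q.mul.toLinearMap ((trivialRight.tensor RightCoaction.regular).toLin
    (v ⊗ₜ[k] h)) = _
  simp only [RightCoaction.tensor, RightCoaction.regular, RightCoaction.push, RightCoaction.base,
    LinearMap.comp_apply, LinearEquiv.coe_coe, TensorProduct.map_tmul,
    TensorProduct.rid_symm_apply, LinearMap.id_apply]
  induction comul (R := k) h using tensor_ind with
  | add x y hx hy => simp only [map_add, TensorProduct.tmul_add, hx, hy]
  | tmul a b => simp [Q.unit_mul]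

/-- Applying `ε` to the factor `H` of `V ⊗ H` inverts the right coaction of `V ⊗ H`. -/
theorem counit_right_functorF (V : LeftComod k H) (t : V.carrier ⊗[k] H) :
    map ((rid k V.carrier).toLinearMap ∘ₗ map LinearMap.id counit) (LinearMap.id : H →ₗ[k] H)
      (((functorF k H).obj V).X.right.toLin t) = t := by
  have e : ∀ t : V.carrier ⊗[k] H,
      map ((rid k V.carrier).toLinearMap ∘ₗ map LinearMap.id counit) (LinearMap.id : H →ₗ[k] H)
        (((functorF k H).obj V).X.right.toLin t) = t := by
    intro t
    induction t using tensor_ind with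
    | add x y hx hy => rw [map_add, map_add, hx, hy]
    | tmul v h =>
      rw [right_functorF]
      have e1 := congr(v ⊗ₜ[k] lid k H $(Coalgebra.rTensor_counit_comul (R := k) h))
      rw [TensorProduct.lid_tmul, one_smul] at e1
      refine .trans ?_ e1
      simp only [LinearMap.rTensor]
      induction comul (R := k) h using tensor_ind with
      | add x y hx hy => simp only [map_add, TensorProduct.tmul_add, hx, hy]
      | tmul a b => simp [TensorProduct.smul_tmul]
  exact e t

/-- The right coinvariants of `V ⊗ H` are the elements `v ⊗ 1`, if `V` carries the trivial right
coaction. -/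
theorem eq_of_mem_coinv_functorF (V : LeftComod k H)
    {t : V.carrier ⊗[k] H} (ht : t ∈ coinv ((functorF k H).obj V).X) :
    t = rid k V.carrier (map LinearMap.id counit t) ⊗ₜ[k] Q.unit 1 := by
  have h := congr(map ((rid k V.carrier).toLinearMap ∘ₗ map LinearMap.id counit)
    (LinearMap.id : H →ₗ[k] H) $(mem_coinv.1 ht))
  exact (counit_right_functorF V t).symm.trans h

theorem isIso_unit : IsIso (adjFG k H).unit := by
  have : ∀ V, IsIso ((adjFG k H).unit.app V) := by
    intro V
    apply LeftComod.isIso_of_bijective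
    constructor
    · intro v w hvw
      have := congr(rid k V.carrier (map LinearMap.id counit (Subtype.val $hvw)))
      rw [adjFG_unit, adjFG_unit] at this
      simpa using this
    · intro t
      refine ⟨rid k V.carrier (map LinearMap.id counit t.1), Subtype.ext ?_⟩
      rw [adjFG_unit]
      exact (eq_of_mem_coinv_functorF V t.2).symm
  exact NatIso.isIso_of_isIso_app _

/-- The counit of the adjunction `(F, G)` at `M` as a linear map. -/
def counitLin (M : HopfBicomod k H) : coinv M.X ⊗[k] H →ₗ[k] M.X.carrier :=
  Bicomod.Hom.toLin (RightMod.Hom.hom ((adjFG k H).counit.app M))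

theorem counitLin_apply (M : HopfBicomod k H) (t : coinv M.X ⊗[k] H) :
    counitLin M t = HopfBicomod.actLin M (map (coinv M.X).subtype LinearMap.id t) := by
  induction t using tensor_ind with
  | add x y hx hy => simp only [map_add, hx, hy]
  | tmul x h => exact adjFG_counit M x h

theorem isIso_counit_app_iff (M : HopfBicomod k H) :
    IsIso ((adjFG k H).counit.app M) ↔ Function.Bijective (counitLin M) := by
  rw [RightMod.isIso_iff, Bicomod.isIso_iff_bijective]
  rfl

theorem IsPreantipode.bijective_counitLin {S : H →ₗ[k] H} (hS : IsPreantipode S)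
    (M : HopfBicomod k H) : Function.Bijective (counitLin M) := by
  constructor
  · have h : ∀ t, counitInv S M (counitLin M t) = map (coinv M.X).subtype LinearMap.id t := by
      intro t
      rw [counitLin_apply]
      induction t using tensor_ind with
      | add x y hx hy => simp only [map_add, hx, hy]
      | tmul x h => exact hS.counitInv_actLin M x.2 h
    intro s t hst
    apply Module.Flat.rTensor_preserves_injective_linearMap (M := H) (coinv M.X).subtype
      (coinv M.X).injective_subtype
    exact (h s).symm.trans (congr(counitInv S M $hst).trans (h t))
  · intro m
    obtain ⟨t, ht⟩ := hS.counitInv_mem_range M m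
    exact ⟨t, by rw [counitLin_apply, ht, hS.actLin_counitInv]⟩

theorem IsPreantipode.isIso_counit {S : H →ₗ[k] H} (hS : IsPreantipode S) :
    IsIso (adjFG k H).counit := by
  have : ∀ M, IsIso ((adjFG k H).counit.app M) :=
    fun M => (isIso_counit_app_iff M).2 (hS.bijective_counitLin M)
  exact NatIso.isIso_of_isIso_app _

theorem bijective_counitHat [IsIso (adjFG k H).counit] : Function.Bijective (counitHat k H) :=
  (isIso_counit_app_iff (hatTensor k H)).1 inferInstance

/-! ### The preantipode defined by the bijectivity of the counit -/

variable (k H) in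
/-- `H` with the trivial left coaction and the right coaction `Δ`. -/
abbrev trivialLeftRegular : Bicomod k H where
  carrier := H
  left := trivialLeft
  right := RightCoaction.regular
  commute := by
    have h := (Commute.base_left (k := k) (RightCoaction.regular (k := k) (C := H))).push
      Q.unit (CoalgHom.id k H)
    have e : (RightCoaction.regular (k := k) (C := H)).push (CoalgHom.id k H) =
        RightCoaction.regular := by
      simp [RightCoaction.push, RightCoaction.regular]
    rwa [e] at h

/-- The bicomodule endomorphism `h ↦ φ(h₁) h₂`. -/
def actHom (φ : H →ₗ[k] k) : trivialLeftRegular k H ⟶ trivialLeftRegular k H where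
  toLin := LeftCoaction.regular.act φ
  left_colinear := by
    ext h
    simp [LeftCoaction.push, LeftCoaction.base]
  right_colinear := LinearMap.ext fun h => Commute.regular.toLin_act_left φ h

theorem right_hatTensor_tmul_unit (h : H) :
    (hatTensor k H).X.right.toLin (h ⊗ₜ[k] Q.unit 1) =
      map ((TensorProduct.mk k H H).flip (Q.unit 1)) LinearMap.id (comul (R := k) h) := by
  change map LinearMap.id Q.mul.toLinearMap
    ((RightCoaction.regular.tensor RightCoaction.regular).toLin (h ⊗ₜ[k] Q.unit 1)) = _
  simp only [RightCoaction.tensor, RightCoaction.regular,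
    LinearMap.comp_apply, LinearEquiv.coe_coe, TensorProduct.map_tmul, comul_unit]
  induction comul (R := k) h using tensor_ind with
  | add x y hx hy => simp only [map_add, TensorProduct.add_tmul, hx, hy]
  | tmul a b => simp [Q.mul_unit]

theorem left_hatTensor_tmul_unit (h : H) :
    (hatTensor k H).X.left.toLin (h ⊗ₜ[k] Q.unit 1) = Q.unit 1 ⊗ₜ[k] (h ⊗ₜ[k] Q.unit 1) := by
  change map Q.mul.toLinearMap LinearMap.id
    ((trivialLeft.tensor LeftCoaction.regular).toLin (h ⊗ₜ[k] Q.unit 1)) = _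
  simp [LeftCoaction.tensor, LeftCoaction.push, LeftCoaction.base, LeftCoaction.regular,
    comul_unit, Q.mul_unit]

/-- `ε ⊗ H : H ⊗̂ H → H` is left colinear. -/
theorem left_over_counit_hatTensor :
    LeftCoaction.Over LinearMap.id ((lid k H).toLinearMap ∘ₗ map counit LinearMap.id)
      (hatTensor k H).X.left (LeftCoaction.regular (k := k) (C := H)) := by
  unfold LeftCoaction.Over
  refine TensorProduct.ext' fun a b => ?_
  change _ = map LinearMap.id _ (map Q.mul.toLinearMap LinearMap.id
    ((trivialLeft.tensor LeftCoaction.regular).toLin (a ⊗ₜ[k] b)))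
  simp only [LeftCoaction.tensor, LeftCoaction.regular, LeftCoaction.push, LeftCoaction.base,
    LinearMap.comp_apply, LinearEquiv.coe_coe, TensorProduct.map_tmul,
    TensorProduct.lid_symm_apply, LinearMap.id_apply, TensorProduct.lid_tmul, map_smul]
  induction comul (R := k) b using tensor_ind with
  | add x y hx hy => simp only [map_add, TensorProduct.tmul_add, smul_add, hx, hy]
  | tmul c d => simp [Q.unit_mul]

/-- `ε ⊗ ε` maps `(a ⊗ b)c`, computed in `H ⊗̂ H`, to `ω(a ⊗ b ⊗ c)`. The factor `ω⁻¹` of the action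
is trivial because the left coaction on the first copy of `H` is. -/
theorem counit_actLin_hatTensor (y : (H ⊗[k] H) ⊗[k] H) :
    counit (R := k) (A := H ⊗[k] H) (HopfBicomod.actLin (hatTensor k H) y) = Q.reassoc y := by
  have e1 : HopfBicomod.actLin (hatTensor k H) y = map LinearMap.id Q.mul.toLinearMap
      (Bicomod.assocLin (trivialLeftRegular k H) (Bicomod.regular k H) (Bicomod.regular k H) y) :=
    rfl
  let R := LeftCoaction.regular (k := k) (C := H)
  have hl := (((LeftCoaction.Over.push Q.unit (LeftCoaction.base (k := k) (M := H))).tensor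
    (LeftCoaction.Over.id R)).tensor (LeftCoaction.Over.id R)).act Q.reassocInv y
  rw [reassocInv_unit_left, LeftCoaction.act_counit] at hl
  simp only [TensorProduct.map_id, LinearMap.id_apply] at hl
  have e2 : ∀ z : (H ⊗[k] H) ⊗[k] H, counit (R := k)
      (map (LinearMap.id : H →ₗ[k] H) Q.mul.toLinearMap (assoc k H H H z)) =
        counit (R := k) z := by
    intro z
    induction z using tensor_ind with
    | add x y hx hy => simp only [map_add, hx, hy]
    | tmul a c =>
      induction a using tensor_ind with
      | add x y hx hy => simp only [map_add, TensorProduct.add_tmul, hx, hy]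
      | tmul a b => simp [mul_comm, mul_left_comm]
  rw [e1, Bicomod.assocLin, LinearMap.comp_apply, LinearMap.comp_apply]
  have e3 : (Bicomod.left3 (trivialLeftRegular k H) (Bicomod.regular k H)
      (Bicomod.regular k H)).act Q.reassocInv y = y := hl
  rw [e3]
  exact (e2 _).trans (counit_act_right Q.reassoc y)

/-- Applying `ε` to the superfluous factor turns the coinvariance of `S(h₁) ⊗ h₂` and
`h₁ ⊗ S(h₂)` into the colinearity conditions of a preantipode. -/
theorem isPreantipode_of_coinvariant {S : H →ₗ[k] H}
    (h1 : ∀ h, ((LeftCoaction.regular.tensor LeftCoaction.regular).push Q.mul).toLin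
      (leftTwist S h) = Q.unit 1 ⊗ₜ[k] leftTwist S h)
    (h2 : ∀ h, ((RightCoaction.regular.tensor RightCoaction.regular).push Q.mul).toLin
      (rightTwist RightCoaction.regular S h) =
        rightTwist RightCoaction.regular S h ⊗ₜ[k] Q.unit 1)
    (h3 : ∀ h, Q.reassoc (twist RightCoaction.regular S h) = counit (R := k) h) :
    IsPreantipode S where
  left_colinear h := by
    let K : H ⊗[k] (H ⊗[k] H) →ₗ[k] H ⊗[k] H :=
      map LinearMap.id ((rid k H).toLinearMap ∘ₗ map LinearMap.id counit)
    have e : ∀ (A : H →ₗ[k] H ⊗[k] H) (t : H ⊗[k] H),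
        K (assoc k H H H (map A LinearMap.id t)) = rid k _ (map LinearMap.id counit (map A
          LinearMap.id t)) := by
      intro A t
      induction t using tensor_ind with
      | add x y hx hy => simp only [map_add, hx, hy]
      | tmul a b =>
        simp only [TensorProduct.map_tmul, LinearMap.id_apply]
        induction A a using tensor_ind with
        | add x y hx hy => simp only [map_add, TensorProduct.add_tmul, hx, hy]
        | tmul a c => simp [K]
    have e0 : ∀ (P : Type u) [AddCommGroup P] [Module k P] (A : H →ₗ[k] P),
        rid k _ (map LinearMap.id counit (map A LinearMap.id (comul (R := k) h))) = A h := by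
      intro P _ _ A
      have := congr(A (rid k H $(Coalgebra.lTensor_counit_comul (R := k) h)))
      rw [TensorProduct.rid_tmul, one_smul] at this
      refine .trans ?_ this
      simp only [LinearMap.lTensor]
      induction comul (R := k) h using tensor_ind with
      | add x y hx hy => simp only [map_add, hx, hy]
      | tmul a b => simp
    have := congr(K $(h1 h))
    rw [left_leftTwist_eq, e, e0] at this
    refine this.trans ?_
    simp only [K, TensorProduct.map_tmul, LinearMap.id_apply, leftTwist, LinearMap.comp_apply]
    exact congr(_ ⊗ₜ[k] $(e0 H S))
  right_colinear h := by
    let K : (H ⊗[k] H) ⊗[k] H →ₗ[k] H ⊗[k] H :=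
      map ((lid k H).toLinearMap ∘ₗ map counit LinearMap.id) LinearMap.id
    have e : ∀ (A : H →ₗ[k] H ⊗[k] H) (t : H ⊗[k] H),
        K ((assoc k H H H).symm (map LinearMap.id A t)) = lid k _ (map counit LinearMap.id
          (map LinearMap.id A t)) := by
      intro A t
      induction t using tensor_ind with
      | add x y hx hy => simp only [map_add, hx, hy]
      | tmul a b =>
        simp only [TensorProduct.map_tmul, LinearMap.id_apply]
        induction A b using tensor_ind with
        | add x y hx hy => simp only [map_add, TensorProduct.tmul_add, hx, hy]
        | tmul a c => simp [K, TensorProduct.smul_tmul']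
    have e0 : ∀ (P : Type u) [AddCommGroup P] [Module k P] (A : H →ₗ[k] P),
        lid k _ (map counit LinearMap.id (map LinearMap.id A (comul (R := k) h))) = A h := by
      intro P _ _ A
      have := congr(A (lid k H $(Coalgebra.rTensor_counit_comul (R := k) h)))
      rw [TensorProduct.lid_tmul, one_smul] at this
      refine .trans ?_ this
      simp only [LinearMap.rTensor]
      induction comul (R := k) h using tensor_ind with
      | add x y hx hy => simp only [map_add, hx, hy]
      | tmul a b => simp
    have := congr(K $(h2 h))
    rw [right_rightTwist_eq] at this
    refine ((e0 _ _).symm.trans (e _ _).symm).trans (this.trans ?_)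
    simp only [K, TensorProduct.map_tmul, LinearMap.id_apply, rightTwist, LinearMap.comp_apply]
    exact congr($(e0 H S) ⊗ₜ[k] _)
  reassoc_eq := h3

/-- The preantipode is `S = (ε ⊗ H ⊗ ε) ∘ ε̂⁻¹ ∘ (H ⊗ u)`. -/
theorem exists_isPreantipode (hc : Function.Bijective (counitHat k H)) :
    ∃ S : H →ₗ[k] H, IsPreantipode S := by
  let N : LeftComod k H := (functorG k H).obj (hatTensor k H)
  let ι : N.carrier →ₗ[k] H ⊗[k] H := (coinv (hatTensor k H).X).subtype
  let c : ((functorF k H).obj N).X ≅ (hatTensor k H).X :=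
    Bicomod.isoOfBijective (RightMod.Hom.hom ((adjFG k H).counit.app (hatTensor k H))) hc
  let g : H ⊗[k] H →ₗ[k] N.carrier ⊗[k] H := Bicomod.Hom.toLin c.inv
  have hgc : ∀ t : N.carrier ⊗[k] H, g (counitLin (hatTensor k H) t) = t :=
    fun t => congr(Bicomod.Hom.toLin $(c.hom_inv_id) t)
  have hcg : ∀ t : H ⊗[k] H, counitLin (hatTensor k H) (g t) = t :=
    fun t => congr(Bicomod.Hom.toLin $(c.inv_hom_id) t)
  let T : H →ₗ[k] N.carrier ⊗[k] H := g ∘ₗ (TensorProduct.mk k H H).flip (Q.unit 1)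
  have hcT : ∀ h, counitLin (hatTensor k H) (T h) = h ⊗ₜ[k] Q.unit 1 := fun h => hcg _
  let T' : H →ₗ[k] N.carrier := (rid k _).toLinearMap ∘ₗ map LinearMap.id counit ∘ₗ T
  let S : H →ₗ[k] H := (lid k H).toLinearMap ∘ₗ map counit LinearMap.id ∘ₗ ι ∘ₗ T'
  -- right colinearity of the inverse of the counit
  have hT : ∀ h, T h = map T' LinearMap.id (comul (R := k) h) := by
    intro h
    have e := congr($(c.inv.right_colinear) (h ⊗ₜ[k] Q.unit 1))
    rw [LinearMap.comp_apply, LinearMap.comp_apply] at e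
    have e1 := congr(map g LinearMap.id $(right_hatTensor_tmul_unit h))
    rw [TensorProduct.map_map] at e1
    have e2 := counit_right_functorF N (T h)
    refine e2.symm.trans ((congr(map ((rid k N.carrier).toLinearMap ∘ₗ map LinearMap.id counit)
      (LinearMap.id : H →ₗ[k] H) $(e.trans e1))).trans ?_)
    rw [TensorProduct.map_map]
    rfl
  -- naturality of the counit at the endomorphism `h ⊗ l ↦ φ(h₁) h₂ ⊗ l` of `H ⊗̂ H`
  have hnat : ∀ φ : H →ₗ[k] k, ∃ ρ : N.carrier →ₗ[k] N.carrier,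
      (∀ n, ι (ρ n) = map (LeftCoaction.regular.act φ) LinearMap.id (ι n)) ∧
      ∀ t : N.carrier ⊗[k] H, counitLin (hatTensor k H) (map ρ LinearMap.id t) =
        map (LeftCoaction.regular.act φ) LinearMap.id (counitLin (hatTensor k H) t) := by
    intro φ
    let f := (RightMod.free (Bicomod.regular k H)).map (actHom φ)
    exact ⟨LeftComod.Hom.toLin ((functorG k H).map f), fun _ => rfl, fun t =>
      congr(Bicomod.Hom.toLin (RightMod.Hom.hom $((adjFG k H).counit.naturality f)) t)⟩
  have hT' : ∀ (φ : H →ₗ[k] k) (h : H), ι (T' (LeftCoaction.regular.act φ h)) =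
      map (LeftCoaction.regular.act φ) LinearMap.id (ι (T' h)) := by
    intro φ h
    obtain ⟨ρ, h1, h2⟩ := hnat φ
    have e : T (LeftCoaction.regular.act φ h) = map ρ LinearMap.id (T h) := by
      refine .trans ?_ (hgc _)
      rw [h2, hcT, TensorProduct.map_tmul]
      rfl
    rw [← h1]
    have e' : ∀ t : N.carrier ⊗[k] H, rid k _ (map LinearMap.id counit (map ρ LinearMap.id t)) =
        ρ (rid k _ (map LinearMap.id counit t)) := by
      intro t
      induction t using tensor_ind with
      | add x y hx hy => simp only [map_add, hx, hy]
      | tmul n a => simp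
    refine congr(ι $(.trans ?_ (e' (T h))))
    rw [← e]
    rfl
  -- `T'(h) = h₁ ⊗ S(h₂)`: by `hT'`, both sides are mapped to `φ(h₁) S(h₂)` by `φ ⊗ H`, for every
  -- functional `φ`
  have hq : ∀ h, ι (T' h) = rightTwist RightCoaction.regular S h := by
    intro h
    apply eq_of_forall_functional
    intro φ
    have e1 : S (LeftCoaction.regular.act φ h) = lid k H (map φ LinearMap.id (ι (T' h))) := by
      have : counit ∘ₗ LeftCoaction.regular.act φ = φ := LinearMap.ext (counit_act_left φ)
      change lid k H (map counit LinearMap.id (ι (T' (LeftCoaction.regular.act φ h)))) = _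
      rw [hT', TensorProduct.map_map, this, LinearMap.id_comp]
    have e2 : ∀ t : H ⊗[k] H, lid k H (map φ LinearMap.id (map LinearMap.id S t)) =
        S (lid k H (map φ LinearMap.id t)) := by
      intro t
      induction t using tensor_ind with
      | add x y hx hy => simp only [map_add, hx, hy]
      | tmul n a => simp
    exact e1.symm.trans (e2 _).symm
  have hw : ∀ h, map ι LinearMap.id (T h) = twist RightCoaction.regular S h := by
    intro h
    rw [hT, TensorProduct.map_map, twist_apply]
    have : ι ∘ₗ T' = rightTwist RightCoaction.regular S := LinearMap.ext hq
    rw [this]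
    rfl
  refine ⟨S, isPreantipode_of_coinvariant (fun h => ?_) (fun h => ?_) fun h => ?_⟩
  -- left colinearity of the inverse of the counit, of the inclusion of the coinvariants, and of
  -- `ε ⊗ H` together give the left coinvariance of `S(h₁) ⊗ h₂`
  · have e := congr($(c.inv.left_colinear) (h ⊗ₜ[k] Q.unit 1))
    have e1 := congr(map LinearMap.id g $(left_hatTensor_tmul_unit h))
    have e2 := congr($((Bicomod.tensorMap ((adjLR k H).counit.app (hatTensor k H).X)
      (𝟙 (Bicomod.regular k H))).left_colinear) (T h))
    have e3 := congr(map LinearMap.id (map ι (LinearMap.id : H →ₗ[k] H)) $(e.trans e1))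
    let R := LeftCoaction.regular (k := k) (C := H)
    have hα := (LeftCoaction.Over.push Q.mul (R.tensor R)).comp
      (left_over_counit_hatTensor.tensor (LeftCoaction.Over.id R))
    have e4 := congr($hα (map ι LinearMap.id (T h)))
    let α : H ⊗[k] H →ₗ[k] H := (lid k H).toLinearMap ∘ₗ map counit LinearMap.id
    have e5 : map α LinearMap.id (map ι LinearMap.id (T h)) = leftTwist S h := by
      rw [hT, TensorProduct.map_map, TensorProduct.map_map]
      rfl
    have e6 := congr(map LinearMap.id (map α (LinearMap.id : H →ₗ[k] H)) $(e2.trans e3))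
    have e7 : ∀ y, map (Q.mul.toLinearMap ∘ₗ map LinearMap.id LinearMap.id)
        (LinearMap.id ∘ₗ map α (LinearMap.id : H →ₗ[k] H)) y =
        map LinearMap.id (map α LinearMap.id) (map Q.mul.toLinearMap LinearMap.id y) := by
      intro y
      rw [TensorProduct.map_map, TensorProduct.map_id, LinearMap.id_comp, LinearMap.comp_id,
        LinearMap.id_comp, LinearMap.comp_id]
    refine congr(((R.tensor R).push Q.mul).toLin $e5).symm.trans
      ((e4.trans (e7 _)).trans (e6.trans ?_))
    exact congr(Q.unit 1 ⊗ₜ[k] $e5)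
  · rw [← hq]
    exact mem_coinv.1 (T' h).2
  -- `ε ⊗ ε` applied to `(h₁ ⊗ S(h₂)) h₃ = h ⊗ 1`
  · rw [← counit_actLin_hatTensor, ← hw]
    refine congr(counit (R := k) (A := H ⊗[k] H)
      $((counitLin_apply (hatTensor k H) (T h)).symm.trans (hcT h))).trans ?_
    simp

end

end DualQuasi

theorem mainTheorem1 (k H : Type u) [Field k] [AddCommGroup H] [Module k H] [Coalgebra k H]
    [DualQuasi.DualQuasiBialgebra k H] :
    List.TFAE [
      CategoryTheory.IsIso (DualQuasi.adjFG k H).unit ∧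
        CategoryTheory.IsIso (DualQuasi.adjFG k H).counit,
      Function.Bijective (DualQuasi.counitHat k H),
      ∃ S : H →ₗ[k] H, DualQuasi.IsPreantipode S] := by
  tfae_have 1 → 2 := fun ⟨_, _⟩ => DualQuasi.bijective_counitHat
  tfae_have 2 → 3 := DualQuasi.exists_isPreantipode
  tfae_have 3 → 1 := fun ⟨_, hS⟩ => ⟨DualQuasi.isIso_unit, hS.isIso_counit⟩
  tfae_finish
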